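/- Let $V_n=(M,g)$ and $\bar V_n=(\bar M,\bar g)$ be smooth $n$-dimensional pseudo-Riemannian manifolds (metrics of any signature) with Levi-Civita connections $\nabla$ and $\bar\nabla$. A geodesic mapping of $V_n$ onto $\bar V_n$ is a diffeomorphism $f\colon M\to\bar M$ that maps every geodesic curve of $V_n$ onto a geodesic curve of $\bar V_n$; here a geodesic curve is a regular smooth curve $\gamma$, in any parametrization, with $\nabla_{\dot\gamma}\dot\gamma=\kappa\,\dot\gamma$ for some function $\kappa$ of the parameter. A smooth vector field $\varphi$ on $V_n$ is concircular if there is a smooth function $\varrho$ on $M$ such that $g(\nabla_Y\varphi,X)=\varrho\,g(X,Y)$ for all vector fields $X,Y$; it is of the basic type if $\varrho$ is not identically zero. Theorem. Suppose that $V_n$ admits a geodesic mapping onto $\bar V_n$. If $\bar V_n$ carries a concircular field of the basic type, then $V_n$ also carries a concircular field of the basic type. Moreover, if $V_n$ carries a concircular field of the basic type, then so does $\bar V_n$; thus the class of pseudo-Riemannian manifolds carrying a concircular field of the basic type (equidistant spaces of the basic type) is closed under geodesic mappings. -/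

import Mathlib

open scoped Manifold ContDiff

noncomputable section

/-- A smooth pseudo-Riemannian metric on a manifold `M` modelled on `E`: a smooth field of
symmetric nondegenerate bilinear forms on the tangent spaces (of any signature). -/
structure PseudoRiemannianMetric (E : Type*) [NormedAddCommGroup E] [NormedSpace ℝ E]
    (M : Type*) [TopologicalSpace M] [ChartedSpace E M] [IsManifold 𝓘(ℝ, E) ∞ M] where
  /-- The bilinear form on each tangent space. -/
  form (p : M) : TangentSpace 𝓘(ℝ, E) p →L[ℝ] TangentSpace 𝓘(ℝ, E) p →L[ℝ] ℝ
  symm (p : M) (v w : TangentSpace 𝓘(ℝ, E) p) : form p v w = form p w v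
  nondegenerate (p : M) (v : TangentSpace 𝓘(ℝ, E) p) : (∀ w, form p v w = 0) → v = 0
  contMDiff : ContMDiff 𝓘(ℝ, E) (𝓘(ℝ, E).prod 𝓘(ℝ, E →L[ℝ] E →L[ℝ] ℝ)) ∞
    (fun p ↦ Bundle.TotalSpace.mk' (E →L[ℝ] E →L[ℝ] ℝ)
      (E := fun p : M ↦ TangentSpace 𝓘(ℝ, E) p →L[ℝ] TangentSpace 𝓘(ℝ, E) p →L[ℝ] ℝ) p (form p))

namespace PseudoRiemannianMetric

variable {E : Type*} [NormedAddCommGroup E] [NormedSpace ℝ E]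
  {M : Type*} [TopologicalSpace M] [ChartedSpace E M] [IsManifold 𝓘(ℝ, E) ∞ M]

/-- The components of the metric in the coordinate system `e`, at the coordinates `y`: the
bilinear form `g (∂_u, ∂_v)` of two coordinate vectors `u v : E`. -/
def inChart (g : PseudoRiemannianMetric E M) (e : OpenPartialHomeomorph M E) (y : E) :
    E →L[ℝ] E →L[ℝ] ℝ :=
  ContinuousLinearMap.bilinearComp (E := E) (F := E) (E' := E) (F' := E) (G := ℝ)
    (g.form (e.symm y))
    (mfderiv 𝓘(ℝ, E) 𝓘(ℝ, E) e.symm y) (mfderiv 𝓘(ℝ, E) 𝓘(ℝ, E) e.symm y)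

/-- The Christoffel symbols of the first kind, as a linear form in the last argument `w`:
`½ (∂_u g(v, w) + ∂_v g(u, w) - ∂_w g(u, v))`. -/
def christoffelFirst (g : PseudoRiemannianMetric E M) (e : OpenPartialHomeomorph M E)
    (y u v : E) : E →L[ℝ] ℝ :=
  (1 / 2 : ℝ) • (fderiv ℝ (g.inChart e) y u v + fderiv ℝ (g.inChart e) y v u
    - ((fderiv ℝ (g.inChart e) y).flip u).flip v)

/-- The Christoffel symbols (of the second kind) of the Levi-Civita connection in the coordinate
system `e`: the vector `Γ(u, v)` obtained by raising the index of `christoffelFirst`. -/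
def christoffel (g : PseudoRiemannianMetric E M) (e : OpenPartialHomeomorph M E)
    (y u v : E) : E :=
  ContinuousLinearMap.inverse (g.inChart e y) (g.christoffelFirst e y u v)

end PseudoRiemannianMetric

section Fields

variable {E : Type*} [NormedAddCommGroup E] [NormedSpace ℝ E]
  {M : Type*} [TopologicalSpace M] [ChartedSpace E M] [IsManifold 𝓘(ℝ, E) ∞ M]

/-- The components of a vector field in the coordinate system `e`, at the coordinates `y`. -/
def vectorInChart (X : (p : M) → TangentSpace 𝓘(ℝ, E) p) (e : OpenPartialHomeomorph M E)
    (y : E) : E :=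
  mfderiv 𝓘(ℝ, E) 𝓘(ℝ, E) e (e.symm y) (X (e.symm y))

/-- The covariant derivative `∇_u X` with respect to the Levi-Civita connection of `g`,
in the coordinate system `e`: `∂_u X + Γ(u, X)`. -/
def covDerivInChart (g : PseudoRiemannianMetric E M) (X : (p : M) → TangentSpace 𝓘(ℝ, E) p)
    (e : OpenPartialHomeomorph M E) (y u : E) : E :=
  fderiv ℝ (vectorInChart X e) y u + g.christoffel e y u (vectorInChart X e y)

/-- `φ` is a concircular vector field with the scalar field `ρ`: both are smooth, and
`g (∇_Y φ, X) = ρ g (X, Y)` for all `X`, `Y` (in every coordinate system). -/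
structure IsConcircular (g : PseudoRiemannianMetric E M) (φ : (p : M) → TangentSpace 𝓘(ℝ, E) p)
    (ρ : M → ℝ) : Prop where
  smooth_field : ContMDiff 𝓘(ℝ, E) 𝓘(ℝ, E).tangent ∞
    (fun p ↦ (⟨p, φ p⟩ : TangentBundle 𝓘(ℝ, E) M))
  smooth_scalar : ContMDiff 𝓘(ℝ, E) 𝓘(ℝ, ℝ) ∞ ρ
  eq : ∀ e ∈ IsManifold.maximalAtlas 𝓘(ℝ, E) ∞ M, ∀ y ∈ e.target, ∀ X Y : E,
    g.inChart e y (covDerivInChart g φ e y Y) X = ρ (e.symm y) * g.inChart e y X Y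

/-- The space carries a concircular field of the basic type: the scalar field `ρ` is not
identically zero. -/
def HasBasicConcircularField (g : PseudoRiemannianMetric E M) : Prop :=
  ∃ (φ : (p : M) → TangentSpace 𝓘(ℝ, E) p) (ρ : M → ℝ), IsConcircular g φ ρ ∧ ∃ p, ρ p ≠ 0

/-- `γ` restricted to the open interval `J` is a geodesic curve of `g`, in an arbitrary
regular parametrization: it is smooth, its velocity vanishes nowhere, and `∇_{γ'} γ' = κ γ'` for
some function `κ` (in every coordinate system). -/
structure IsGeodesicCurve (g : PseudoRiemannianMetric E M) (J : Set ℝ) (γ : ℝ → M) : Prop where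
  isOpen : IsOpen J
  isPreconnected : IsPreconnected J
  smooth : ContMDiffOn 𝓘(ℝ, ℝ) 𝓘(ℝ, E) ∞ γ J
  regular : ∀ t ∈ J, mfderiv 𝓘(ℝ, ℝ) 𝓘(ℝ, E) γ t ≠ 0
  eq : ∃ κ : ℝ → ℝ, ∀ t ∈ J, ∀ e ∈ IsManifold.maximalAtlas 𝓘(ℝ, E) ∞ M, γ t ∈ e.source →
    deriv (deriv (e ∘ γ)) t + g.christoffel e (e (γ t)) (deriv (e ∘ γ) t) (deriv (e ∘ γ) t)
      = κ t • deriv (e ∘ γ) t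

variable {M' : Type*} [TopologicalSpace M'] [ChartedSpace E M'] [IsManifold 𝓘(ℝ, E) ∞ M']

/-- A geodesic mapping: a diffeomorphism that maps every geodesic curve to a geodesic curve. -/
def IsGeodesicMapping (g : PseudoRiemannianMetric E M) (g' : PseudoRiemannianMetric E M')
    (f : M ≃ₘ⟮𝓘(ℝ, E), 𝓘(ℝ, E)⟯ M') : Prop :=
  ∀ (J : Set ℝ) (γ : ℝ → M), IsGeodesicCurve g J γ → IsGeodesicCurve g' J (f ∘ γ)

/-- `(M, g)` admits a geodesic mapping onto `(M', g')`. -/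
def AdmitsGeodesicMapping (g : PseudoRiemannianMetric E M)
    (g' : PseudoRiemannianMetric E M') : Prop :=
  ∃ f : M ≃ₘ⟮𝓘(ℝ, E), 𝓘(ℝ, E)⟯ M', IsGeodesicMapping g g' f

end Fields

end

/-
A geodesic mapping turns the Levi-Civita connection `Γ` of `g` into `Γ + ψ ⊗ id + id ⊗ ψ` for the
pulled back metric `h`, since both connections have the same unparametrized geodesics. Comparing
traces gives `ψ = dΨ` with `Ψ = log |det (g⁻¹ h)| / (2 (n + 1))`. If `X` is concircular for `g`
with scalar `ρ`, then `P = exp (-Ψ) X` is concircular for `h` with scalar `exp (-Ψ) (ρ + ψ (X))`.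

Suppose that all concircular fields of `h` are parallel. Then so is `P`, and `ψ (P)` vanishes only
where `ρ` does. The fields `A = exp (-2 Ψ) g⁻¹ h` and `l = exp (-2 Ψ) grad_g Ψ` satisfy Sinyukov's
equation `(∇_u A) v = h (u, v) l + h (l, v) u`, and `h (l, w) = ψ (A w)`. Evaluating its curvature
identity on the parallel field `P` shows that `∇l` is a multiple of the identity where `P ≠ 0`,
so `l` is parallel there. If the moments `h (l, A ^ k P)`, `k < m`, vanish, then
`2 h (l, A ^ m P) A P - h (A ^ (m + 1) P, P) l` is concircular for a scalar proportional to the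
moment of order `m`, which therefore vanishes as well. As `A` is injective, `P = A w` with `w` in
the span of the `A ^ k P`, whence `ψ (P) = h (l, w) = 0`.
-/

set_option maxSynthPendingDepth 3

noncomputable section

section Calculus

variable {E F G H : Type*} [NormedAddCommGroup E] [NormedSpace ℝ E] [NormedAddCommGroup F]
  [NormedSpace ℝ F] [NormedAddCommGroup G] [NormedSpace ℝ G] [NormedAddCommGroup H]
  [NormedSpace ℝ H] {D : Set E} {y : E}

lemma differentiableAt_of_contDiffOn {X : E → F} (hX : ContDiffOn ℝ ∞ X D) (hD : IsOpen D)
    (hy : y ∈ D) : DifferentiableAt ℝ X y :=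
  (hX.contDiffAt (hD.mem_nhds hy)).differentiableAt (by simp)

lemma fderiv_clm_apply_apply {c : E → F →L[ℝ] G} {X : E → F} (hc : DifferentiableAt ℝ c y)
    (hX : DifferentiableAt ℝ X y) (u : E) :
    fderiv ℝ (fun z ↦ c z (X z)) y u = fderiv ℝ c y u (X y) + c y (fderiv ℝ X y u) := by
  rw [fderiv_clm_apply hc hX]
  simp [add_comm]

lemma fderiv_bilin_apply_apply {c : E → F →L[ℝ] G →L[ℝ] H} {X : E → F} {Y : E → G}
    (hc : DifferentiableAt ℝ c y) (hX : DifferentiableAt ℝ X y) (hY : DifferentiableAt ℝ Y y)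
    (u : E) : fderiv ℝ (fun z ↦ c z (X z) (Y z)) y u =
      fderiv ℝ c y u (X y) (Y y) + c y (fderiv ℝ X y u) (Y y) + c y (X y) (fderiv ℝ Y y u) := by
  rw [fderiv_clm_apply_apply (hc.clm_apply hX) hY, fderiv_clm_apply_apply hc hX]
  simp

lemma differentiableAt_fderiv_of_contDiffOn {X : E → F} (hX : ContDiffOn ℝ ∞ X D)
    (hD : IsOpen D) (hy : y ∈ D) : DifferentiableAt ℝ (fderiv ℝ X) y :=
  differentiableAt_of_contDiffOn (hX.fderiv_of_isOpen hD (by simp)) hD hy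

lemma fderiv_fderiv_comm {X : E → F} (hX : ContDiffOn ℝ ∞ X D) (hD : IsOpen D) (hy : y ∈ D)
    (u v : E) : fderiv ℝ (fun z ↦ fderiv ℝ X z v) y u = fderiv ℝ (fun z ↦ fderiv ℝ X z u) y v := by
  have hd := differentiableAt_fderiv_of_contDiffOn hX hD hy
  have hsymm : IsSymmSndFDerivAt ℝ X y :=
    (hX.contDiffAt (hD.mem_nhds hy)).isSymmSndFDerivAt
      (by simpa using (mod_cast le_top : ((2 : ℕ∞) : WithTop ℕ∞) ≤ (⊤ : ℕ∞)))
  simpa [fderiv_clm_apply_apply hd (differentiableAt_const _)] using hsymm u v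

end Calculus

section LocalMetrics

open ContinuousLinearMap

variable {E : Type*} [NormedAddCommGroup E] [NormedSpace ℝ E]

/-- The field `b` of bilinear forms restricts to a smooth pseudo-Riemannian metric on the open
subset `D` of the coordinate space. -/
structure IsMetricOn (b : E → E →L[ℝ] E →L[ℝ] ℝ) (D : Set E) : Prop where
  isOpen : IsOpen D
  contDiffOn : ContDiffOn ℝ ∞ b D
  symm : ∀ y ∈ D, ∀ v w, b y v w = b y w v
  nondegenerate : ∀ y ∈ D, ∀ v, (∀ w, b y v w = 0) → v = 0

/-- The Christoffel symbols of the first kind of `b`, as a trilinear map. -/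
def lowerConnection (b : E → E →L[ℝ] E →L[ℝ] ℝ) (y : E) : E →L[ℝ] E →L[ℝ] E →L[ℝ] ℝ :=
  (1 / 2 : ℝ) • (fderiv ℝ b y + (fderiv ℝ b y).flip
    - ((flipₗᵢ ℝ E E ℝ).toContinuousLinearEquiv.toContinuousLinearMap).comp (fderiv ℝ b y).flip)

lemma lowerConnection_apply (b : E → E →L[ℝ] E →L[ℝ] ℝ) (y u v w : E) :
    lowerConnection b y u v w =
      1 / 2 * (fderiv ℝ b y u v w + fderiv ℝ b y v u w - fderiv ℝ b y w u v) := by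
  simp [lowerConnection]

/-- The Christoffel symbols (of the second kind) of `b`, as a bilinear map: the Levi-Civita
connection of `b` minus the flat connection of the coordinate space. -/
def connection (b : E → E →L[ℝ] E →L[ℝ] ℝ) (y : E) : E →L[ℝ] E →L[ℝ] E :=
  (compL ℝ E (E →L[ℝ] ℝ) E (b y).inverse).comp (lowerConnection b y)

lemma connection_apply (b : E → E →L[ℝ] E →L[ℝ] ℝ) (y u v : E) :
    connection b y u v = (b y).inverse (lowerConnection b y u v) := rfl

lemma connection_congr {b b' : E → E →L[ℝ] E →L[ℝ] ℝ} {y : E} (h : b =ᶠ[nhds y] b') :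
    connection b y = connection b' y := by
  simp only [connection, lowerConnection, h.fderiv_eq, h.eq_of_nhds]

/-- The covariant derivative `u ↦ ∇_u X` of the vector field `X` with respect to `b`. -/
def covDeriv (b : E → E →L[ℝ] E →L[ℝ] ℝ) (X : E → E) (y : E) : E →L[ℝ] E :=
  fderiv ℝ X y + (connection b y).flip (X y)

lemma covDeriv_apply (b : E → E →L[ℝ] E →L[ℝ] ℝ) (X : E → E) (y u : E) :
    covDeriv b X y u = fderiv ℝ X y u + connection b y u (X y) := rfl

/-- The covariant derivative `∇_u A` of the field `A` of endomorphisms with respect to `b`. -/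
def covDerivEnd (b : E → E →L[ℝ] E →L[ℝ] ℝ) (A : E → E →L[ℝ] E) (y u : E) : E →L[ℝ] E :=
  fderiv ℝ A y u + (connection b y u).comp (A y) - (A y).comp (connection b y u)

lemma covDerivEnd_apply (b : E → E →L[ℝ] E →L[ℝ] ℝ) (A : E → E →L[ℝ] E) (y u v : E) :
    covDerivEnd b A y u v =
      fderiv ℝ A y u v + connection b y u (A y v) - A y (connection b y u v) := rfl

lemma covDeriv_congr {b : E → E →L[ℝ] E →L[ℝ] ℝ} {X X' : E → E} {y : E} (h : X =ᶠ[nhds y] X') :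
    covDeriv b X y = covDeriv b X' y := by
  simp only [covDeriv, h.fderiv_eq, h.eq_of_nhds]

section Leibniz

variable {b : E → E →L[ℝ] E →L[ℝ] ℝ} {A : E → E →L[ℝ] E} {X Y : E → E} {r : E → ℝ} {y : E}

lemma covDeriv_add (hX : DifferentiableAt ℝ X y) (hY : DifferentiableAt ℝ Y y) :
    covDeriv b (fun z ↦ X z + Y z) y = covDeriv b X y + covDeriv b Y y := by
  simp only [covDeriv, fderiv_fun_add hX hY, map_add]
  abel

lemma covDeriv_sub (hX : DifferentiableAt ℝ X y) (hY : DifferentiableAt ℝ Y y) :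
    covDeriv b (fun z ↦ X z - Y z) y = covDeriv b X y - covDeriv b Y y := by
  simp only [covDeriv, fderiv_fun_sub hX hY, map_sub]
  abel

lemma covDeriv_smul (hr : DifferentiableAt ℝ r y) (hX : DifferentiableAt ℝ X y) (u : E) :
    covDeriv b (fun z ↦ r z • X z) y u = fderiv ℝ r y u • X y + r y • covDeriv b X y u := by
  simp only [covDeriv_apply, fderiv_fun_smul hr hX, map_smul, add_apply, smul_apply,
    smulRight_apply]
  module

lemma covDeriv_clm_apply (hA : DifferentiableAt ℝ A y) (hX : DifferentiableAt ℝ X y) (u : E) :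
    covDeriv b (fun z ↦ A z (X z)) y u = covDerivEnd b A y u (X y) + A y (covDeriv b X y u) := by
  simp only [covDeriv_apply, covDerivEnd_apply, fderiv_clm_apply_apply hA hX, map_add]
  abel

lemma covDerivEnd_smul (hr : DifferentiableAt ℝ r y) (hA : DifferentiableAt ℝ A y) (u : E) :
    covDerivEnd b (fun z ↦ r z • A z) y u = fderiv ℝ r y u • A y + r y • covDerivEnd b A y u := by
  ext v
  simp only [covDerivEnd_apply, fderiv_fun_smul hr hA, map_smul, add_apply, smul_apply,
    smulRight_apply]
  module

end Leibniz

lemma isInvertible_of_nondegenerate [FiniteDimensional ℝ E] (B : E →L[ℝ] E →L[ℝ] ℝ)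
    (hB : ∀ v, (∀ w, B v w = 0) → v = 0) : B.IsInvertible := by
  have hinj : Function.Injective B := by
    refine (injective_iff_map_eq_zero B).2 fun v hv ↦ hB v fun w ↦ by simp [hv]
  have hfin : Module.finrank ℝ E = Module.finrank ℝ (E →L[ℝ] ℝ) := by
    rw [← Subspace.dual_finrank_eq (K := ℝ) (V := E)]
    exact (LinearMap.toContinuousLinearMap (𝕜 := ℝ) (E := E) (F' := ℝ)).finrank_eq
  exact ⟨(LinearMap.linearEquivOfInjective (B : E →ₗ[ℝ] E →L[ℝ] ℝ) hinj
    hfin).toContinuousLinearEquiv, rfl⟩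

namespace IsMetricOn

variable {b : E → E →L[ℝ] E →L[ℝ] ℝ} {D : Set E} {y : E}

lemma ext (hb : IsMetricOn b D) (hy : y ∈ D) {v v' : E} (h : ∀ w, b y v w = b y v' w) :
    v = v' :=
  sub_eq_zero.1 (hb.nondegenerate y hy _ fun w ↦ by simp [h w])

lemma differentiableAt (hb : IsMetricOn b D) (hy : y ∈ D) : DifferentiableAt ℝ b y :=
  differentiableAt_of_contDiffOn hb.contDiffOn hb.isOpen hy

lemma fderiv_symm (hb : IsMetricOn b D) (hy : y ∈ D) (u v w : E) :
    fderiv ℝ b y u v w = fderiv ℝ b y u w v := by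
  have hvw : (fun z ↦ b z v w) =ᶠ[nhds y] fun z ↦ b z w v :=
    Filter.eventually_of_mem (hb.isOpen.mem_nhds hy) fun z hz ↦ hb.symm z hz v w
  simpa [fderiv_bilin_apply_apply (hb.differentiableAt hy) (differentiableAt_const _)
    (differentiableAt_const _)] using DFunLike.congr_fun (hvw.fderiv_eq (𝕜 := ℝ)) u

variable [FiniteDimensional ℝ E]

lemma isInvertible (hb : IsMetricOn b D) (hy : y ∈ D) : (b y).IsInvertible :=
  isInvertible_of_nondegenerate (b y) (hb.nondegenerate y hy)

lemma inverse_contDiffOn (hb : IsMetricOn b D) : ContDiffOn ℝ ∞ (fun y ↦ (b y).inverse) D :=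
  fun y hy ↦ (hb.isInvertible hy).contDiffAt_map_inverse.comp_contDiffWithinAt y
    (hb.contDiffOn y hy)

lemma apply_connection (hb : IsMetricOn b D) (hy : y ∈ D) (u v w : E) :
    b y (connection b y u v) w =
      1 / 2 * (fderiv ℝ b y u v w + fderiv ℝ b y v u w - fderiv ℝ b y w u v) := by
  rw [connection_apply, (hb.isInvertible hy).self_apply_inverse, lowerConnection_apply]

lemma connection_symm (hb : IsMetricOn b D) (hy : y ∈ D) (u v : E) :
    connection b y u v = connection b y v u := by
  refine hb.ext hy fun w ↦ ?_
  rw [hb.apply_connection hy, hb.apply_connection hy, hb.fderiv_symm hy w u v]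
  ring

lemma fderiv_eq (hb : IsMetricOn b D) (hy : y ∈ D) (u v w : E) :
    fderiv ℝ b y u v w = b y (connection b y u v) w + b y v (connection b y u w) := by
  rw [hb.symm y hy v, hb.apply_connection hy, hb.apply_connection hy, hb.fderiv_symm hy v u w,
    hb.fderiv_symm hy u w v]
  ring

lemma connection_unique (hb : IsMetricOn b D) (hy : y ∈ D) (N : E → E → E)
    (hN : ∀ u v, N u v = N v u)
    (hbN : ∀ u v w, fderiv ℝ b y u v w = b y (N u v) w + b y v (N u w)) (u v : E) :
    connection b y u v = N u v := by
  refine hb.ext hy fun w ↦ ?_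
  rw [hb.apply_connection hy, hbN, hbN, hbN, hN w u, hN w v, hN v u,
    hb.symm y hy u, hb.symm y hy v]
  ring

lemma connection_contDiffOn (hb : IsMetricOn b D) : ContDiffOn ℝ ∞ (connection b) D := by
  have hfderiv : ContDiffOn ℝ ∞ (fderiv ℝ b) D :=
    hb.contDiffOn.fderiv_of_isOpen hb.isOpen (by simp)
  have hflip : ContDiffOn ℝ ∞ (fun y ↦ (fderiv ℝ b y).flip) D :=
    (flipₗᵢ ℝ E E (E →L[ℝ] ℝ)).toContinuousLinearEquiv.contDiff.comp_contDiffOn hfderiv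
  have hlower : ContDiffOn ℝ ∞ (lowerConnection b) D :=
    ((hfderiv.add hflip).sub (contDiffOn_const.clm_comp hflip)).const_smul _
  exact ((compL ℝ E (E →L[ℝ] ℝ) E).contDiff.comp_contDiffOn hb.inverse_contDiffOn).clm_comp hlower

lemma covDeriv_contDiffOn (hb : IsMetricOn b D) {X : E → E} (hX : ContDiffOn ℝ ∞ X D) :
    ContDiffOn ℝ ∞ (covDeriv b X) D :=
  (hX.fderiv_of_isOpen hb.isOpen (by simp)).add
    (((flipₗᵢ ℝ E E E).toContinuousLinearEquiv.contDiff.comp_contDiffOn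
      hb.connection_contDiffOn).clm_apply hX)

lemma fderiv_form_apply (hb : IsMetricOn b D) (hy : y ∈ D) {X Y : E → E}
    (hX : DifferentiableAt ℝ X y) (hY : DifferentiableAt ℝ Y y) (u : E) :
    fderiv ℝ (fun z ↦ b z (X z) (Y z)) y u =
      b y (covDeriv b X y u) (Y y) + b y (X y) (covDeriv b Y y u) := by
  rw [fderiv_bilin_apply_apply (hb.differentiableAt hy) hX hY, hb.fderiv_eq hy]
  simp only [covDeriv_apply, map_add, add_apply]
  ring

end IsMetricOn

end LocalMetrics

section Curvature

variable {E : Type*} [NormedAddCommGroup E] [NormedSpace ℝ E]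
  {b : E → E →L[ℝ] E →L[ℝ] ℝ} {D : Set E} {y : E}

/-- The curvature operator `R(x, z) v` of the Levi-Civita connection of `b`, with the sign
convention `R(x, z) = ∇_x ∇_z - ∇_z ∇_x` for constant `x` and `z`. -/
def curvature (b : E → E →L[ℝ] E →L[ℝ] ℝ) (y x z v : E) : E :=
  fderiv ℝ (connection b) y x z v - fderiv ℝ (connection b) y z x v
    + connection b y x (connection b y z v) - connection b y z (connection b y x v)

lemma curvature_swap (b : E → E →L[ℝ] E →L[ℝ] ℝ) (y x z v : E) :
    curvature b y x z v = -curvature b y z x v := by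
  simp only [curvature]
  abel

namespace IsMetricOn

variable [FiniteDimensional ℝ E]

lemma connection_differentiableAt (hb : IsMetricOn b D) (hy : y ∈ D) :
    DifferentiableAt ℝ (connection b) y :=
  differentiableAt_of_contDiffOn hb.connection_contDiffOn hb.isOpen hy

lemma covDeriv_differentiableAt (hb : IsMetricOn b D) (hy : y ∈ D) {X : E → E}
    (hX : ContDiffOn ℝ ∞ X D) (z : E) : DifferentiableAt ℝ (fun w ↦ covDeriv b X w z) y :=
  differentiableAt_of_contDiffOn ((hb.covDeriv_contDiffOn hX).clm_apply contDiffOn_const)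
    hb.isOpen hy

lemma covDeriv_covDeriv_sub (hb : IsMetricOn b D) (hy : y ∈ D) {X : E → E}
    (hX : ContDiffOn ℝ ∞ X D) (x z : E) :
    covDeriv b (fun w ↦ covDeriv b X w z) y x - covDeriv b (fun w ↦ covDeriv b X w x) y z =
      curvature b y x z (X y) := by
  have hdX := differentiableAt_of_contDiffOn hX hb.isOpen hy
  have expand (x z : E) : covDeriv b (fun w ↦ covDeriv b X w z) y x =
      fderiv ℝ (fun w ↦ fderiv ℝ X w z) y x
        + (fderiv ℝ (connection b) y x z (X y) + connection b y z (fderiv ℝ X y x))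
        + connection b y x (fderiv ℝ X y z + connection b y z (X y)) := by
    have hdX' := (differentiableAt_fderiv_of_contDiffOn hX hb.isOpen hy).clm_apply
      (differentiableAt_const z)
    have hΓ := hb.connection_differentiableAt hy
    simp only [covDeriv_apply]
    rw [fderiv_fun_add hdX' ((hΓ.clm_apply (differentiableAt_const z)).clm_apply hdX),
      add_apply,
      fderiv_bilin_apply_apply hΓ (differentiableAt_const z) hdX]
    simp
  rw [expand, expand, fderiv_fderiv_comm hX hb.isOpen hy x z, curvature]
  simp only [map_add]
  abel

lemma fderiv_connection_symm (hb : IsMetricOn b D) (hy : y ∈ D) (u v w : E) :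
    fderiv ℝ (connection b) y u v w = fderiv ℝ (connection b) y u w v := by
  have hvw : (fun z ↦ connection b z v w) =ᶠ[nhds y] fun z ↦ connection b z w v :=
    Filter.eventually_of_mem (hb.isOpen.mem_nhds hy) fun z hz ↦ hb.connection_symm hz v w
  simpa [fderiv_bilin_apply_apply (hb.connection_differentiableAt hy) (differentiableAt_const _)
    (differentiableAt_const _)] using DFunLike.congr_fun (hvw.fderiv_eq (𝕜 := ℝ)) u

lemma curvature_bianchi (hb : IsMetricOn b D) (hy : y ∈ D) (x z v : E) :
    curvature b y x z v + curvature b y z v x + curvature b y v x z = 0 := by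
  simp only [curvature]
  rw [hb.fderiv_connection_symm hy x v z, hb.fderiv_connection_symm hy z v x,
    hb.fderiv_connection_symm hy v x z, hb.connection_symm hy z v, hb.connection_symm hy x v,
    hb.connection_symm hy z x]
  abel

lemma curvature_skew (hb : IsMetricOn b D) (hy : y ∈ D) (x z v w : E) :
    b y (curvature b y x z v) w + b y v (curvature b y x z w) = 0 := by
  have hconst (v : E) : ContDiffOn ℝ ∞ (fun _ ↦ v : E → E) D := contDiffOn_const
  have hform : ContDiffOn ℝ ∞ (fun p ↦ b p v w) D :=
    (hb.contDiffOn.clm_apply contDiffOn_const).clm_apply contDiffOn_const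
  have second (x z : E) : fderiv ℝ (fun p ↦ fderiv ℝ (fun q ↦ b q v w) p z) y x =
      b y (covDeriv b (fun p ↦ covDeriv b (fun _ ↦ v) p z) y x) w
        + b y (covDeriv b (fun _ ↦ v) y z) (covDeriv b (fun _ ↦ w) y x)
        + (b y (covDeriv b (fun _ ↦ v) y x) (covDeriv b (fun _ ↦ w) y z)
        + b y v (covDeriv b (fun p ↦ covDeriv b (fun _ ↦ w) p z) y x)) := by
    have hfst : (fun p ↦ fderiv ℝ (fun q ↦ b q v w) p z) =ᶠ[nhds y] fun p ↦
        b p (covDeriv b (fun _ ↦ v) p z) w + b p v (covDeriv b (fun _ ↦ w) p z) :=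
      Filter.eventually_of_mem (hb.isOpen.mem_nhds hy) fun p hp ↦
        hb.fderiv_form_apply hp (differentiableAt_const v) (differentiableAt_const w) z
    have hdv := hb.covDeriv_differentiableAt hy (hconst v) z
    have hdw := hb.covDeriv_differentiableAt hy (hconst w) z
    have hdb := hb.differentiableAt hy
    rw [hfst.fderiv_eq, fderiv_fun_add ((hdb.clm_apply hdv).clm_apply (differentiableAt_const w))
      ((hdb.clm_apply (differentiableAt_const v)).clm_apply hdw), add_apply,
      hb.fderiv_form_apply hy hdv (differentiableAt_const w),
      hb.fderiv_form_apply hy (differentiableAt_const v) hdw]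
  have hcomm := fderiv_fderiv_comm hform hb.isOpen hy x z
  rw [second, second] at hcomm
  rw [← hb.covDeriv_covDeriv_sub hy (hconst v), ← hb.covDeriv_covDeriv_sub hy (hconst w)]
  simp only [map_sub, sub_apply]
  linear_combination hcomm

lemma curvature_parallel (hb : IsMetricOn b D) (hy : y ∈ D) {P : E → E}
    (hP : ContDiffOn ℝ ∞ P D) (hpar : ∀ w ∈ D, covDeriv b P w = 0) (x z : E) :
    curvature b y x z (P y) = 0 := by
  have hzero (z : E) : (fun w ↦ covDeriv b P w z) =ᶠ[nhds y] fun _ ↦ 0 :=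
    Filter.eventually_of_mem (hb.isOpen.mem_nhds hy) fun w hw ↦ by simp [hpar w hw]
  rw [← hb.covDeriv_covDeriv_sub hy hP, covDeriv_congr (hzero z), covDeriv_congr (hzero x)]
  simp [covDeriv_apply]

-- `b (R(P, z) v, w)` is symmetric in `z, v` (Bianchi) and skew in `v, w`, hence zero.
lemma curvature_parallel_left (hb : IsMetricOn b D) (hy : y ∈ D) {P : E → E}
    (hP : ContDiffOn ℝ ∞ P D) (hpar : ∀ w ∈ D, covDeriv b P w = 0) (z v : E) :
    curvature b y (P y) z v = 0 := by
  have hsymm (z v : E) : curvature b y (P y) z v = curvature b y (P y) v z := by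
    have hbianchi := hb.curvature_bianchi hy (P y) z v
    rw [hb.curvature_parallel hy hP hpar, curvature_swap b y v] at hbianchi
    linear_combination (norm := module) (1 : ℝ) • hbianchi
  have hskew (z v w : E) :
      b y (curvature b y (P y) z v) w = -b y (curvature b y (P y) z w) v := by
    have h := hb.curvature_skew hy (P y) z v w
    rw [hb.symm y hy v] at h
    linear_combination h
  refine hb.nondegenerate y hy _ fun w ↦ ?_
  have hcycle := hskew z v w
  rw [hsymm z w, hskew w z v, hsymm w v, hskew v w z, hsymm v z] at hcycle
  linarith

end IsMetricOn

end Curvature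

section Determinant

variable {E : Type*} [NormedAddCommGroup E] [NormedSpace ℝ E]

lemma det_ne_zero_of_isInvertible {C : E →L[ℝ] E} (hC : C.IsInvertible) : C.det ≠ 0 := by
  obtain ⟨C, rfl⟩ := hC
  exact C.toLinearEquiv.isUnit_det'.ne_zero

lemma trace_inverse_comp_comp {C : E →L[ℝ] E} (hC : C.IsInvertible) (T : E →L[ℝ] E) :
    LinearMap.trace ℝ E (C.inverse.comp (T.comp C)) = LinearMap.trace ℝ E T := by
  obtain ⟨C, rfl⟩ := hC
  rw [ContinuousLinearMap.inverse_equiv]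
  exact LinearMap.trace_conj' (T : E →ₗ[ℝ] E) C.symm.toLinearEquiv

variable [FiniteDimensional ℝ E]

lemma hasDerivAt_det_one_add_smul (K : E →L[ℝ] E) :
    HasDerivAt (fun t : ℝ ↦ (1 + t • K).det) (LinearMap.trace ℝ E K) 0 := by
  set basis := Module.finBasis ℝ E
  set N := LinearMap.toMatrix basis basis (K : E →ₗ[ℝ] E) with hN
  set q := (Matrix.det (1 + (Polynomial.X : Polynomial ℝ) • N.map Polynomial.C)).divX.divX
  have hpoly (t : ℝ) : (1 + t • K).det = 1 + N.trace * t + q.eval t * t ^ 2 := by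
    rw [← Matrix.det_one_add_smul, ContinuousLinearMap.det, ← LinearMap.det_toMatrix basis]
    simp [hN, LinearMap.toMatrix_one]
  rw [LinearMap.trace_eq_matrix_trace ℝ basis]
  have hderiv := (((hasDerivAt_id (0 : ℝ)).const_mul N.trace).const_add 1).add
    ((q.hasDerivAt 0).mul (hasDerivAt_pow 2 (0 : ℝ)))
  exact (hderiv.congr_of_eventuallyEq (.of_forall hpoly)).congr_deriv (by simp [hN])

lemma contDiff_det : ContDiff ℝ ∞ (fun C : E →L[ℝ] E ↦ C.det) := by
  set basis := Module.finBasis ℝ E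
  have hdet (C : E →L[ℝ] E) : C.det = ∑ σ : Equiv.Perm (Fin (Module.finrank ℝ E)),
      (Equiv.Perm.sign σ : ℤ) •
        ∏ i, LinearMap.toContinuousLinearMap (basis.coord (σ i)) (C (basis i)) := by
    rw [ContinuousLinearMap.det, ← LinearMap.det_toMatrix basis, Matrix.det_apply]
    simp [LinearMap.toMatrix_apply, Units.smul_def]
  simp only [hdet]
  exact ContDiff.sum fun σ _ ↦ ContDiff.const_smul _ (contDiff_prod fun i _ ↦
    (ContinuousLinearMap.contDiff _).comp (contDiff_id.clm_apply contDiff_const))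

lemma fderiv_det {C : E →L[ℝ] E} (hC : C.IsInvertible) (L : E →L[ℝ] E) :
    fderiv ℝ (fun C : E →L[ℝ] E ↦ C.det) C L =
      C.det * LinearMap.trace ℝ E (C.inverse.comp L) := by
  have hline : HasDerivAt (fun t : ℝ ↦ C + t • L) L 0 := by
    simpa using ((hasDerivAt_id (0 : ℝ)).smul_const L).const_add C
  have hchain := ((contDiff_det (E := E)).differentiable (by simp) (C + (0 : ℝ) • L)
    ).hasFDerivAt.comp_hasDerivAt 0 hline
  have hfactor (t : ℝ) : (C + t • L).det = C.det * (1 + t • C.inverse.comp L).det := by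
    rw [ContinuousLinearMap.det, ContinuousLinearMap.det, ← LinearMap.det_comp]
    congr 1
    ext v
    simp [hC.self_apply_inverse]
  have hprod := (hasDerivAt_det_one_add_smul (C.inverse.comp L)).const_mul C.det
  simpa using hchain.unique (hprod.congr_of_eventuallyEq (Filter.Eventually.of_forall hfactor))

end Determinant

section FormRatio

variable {V : Type*} [AddCommGroup V] [Module ℝ V] [TopologicalSpace V]

/-- The operator comparing two bilinear forms, `B (formRatio B H v, w) = H (v, w)`. -/
def formRatio (B H : V →L[ℝ] V →L[ℝ] ℝ) : V →L[ℝ] V := B.inverse.comp H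

lemma formRatio_apply {B H : V →L[ℝ] V →L[ℝ] ℝ} (hB : B.IsInvertible) (v : V) :
    B (formRatio B H v) = H v :=
  hB.self_apply_inverse (H v)

/-- The logarithm of the ratio of the volume densities of two bilinear forms, normalised so that
for projectively equivalent metrics it is a potential of the one-form of the projective change.
Signatures do not matter, as `Real.log` is the logarithm of the absolute value. -/
def volumePotential (B H : V →L[ℝ] V →L[ℝ] ℝ) : ℝ :=
  (2 * (Module.finrank ℝ V + 1 : ℝ))⁻¹ * Real.log (formRatio B H).det

end FormRatio

section ProjectiveChange

variable {E : Type*} [NormedAddCommGroup E] [NormedSpace ℝ E]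
  {a b : E → E →L[ℝ] E →L[ℝ] ℝ} {D : Set E} {y : E} {ψ : E →L[ℝ] ℝ}

/-- Weyl's condition: at the point `y`, the Levi-Civita connections of `a` and `b` differ by
`ψ ⊗ id + id ⊗ ψ`. -/
def IsProjectiveChange (a b : E → E →L[ℝ] E →L[ℝ] ℝ) (ψ : E →L[ℝ] ℝ) (y : E) : Prop :=
  ∀ u v, connection b y u v = connection a y u v + ψ u • v + ψ v • u

/-- Sinyukov's equation `(∇_u A) v = b (u, v) l + b (l, v) u` for a smooth field `A` of
endomorphisms, self-adjoint with respect to `b`, and a smooth vector field `l`. -/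
structure IsSinyukovOn (b : E → E →L[ℝ] E →L[ℝ] ℝ) (A : E → E →L[ℝ] E) (l : E → E)
    (D : Set E) : Prop where
  contDiffOn_end : ContDiffOn ℝ ∞ A D
  contDiffOn_field : ContDiffOn ℝ ∞ l D
  self_adjoint : ∀ y ∈ D, ∀ v w, b y (A y v) w = b y v (A y w)
  covDerivEnd_apply : ∀ y ∈ D, ∀ u v, covDerivEnd b A y u v = b y u v • l y + b y (l y) v • u

lemma IsProjectiveChange.symm (h : IsProjectiveChange a b ψ y) : IsProjectiveChange b a (-ψ) y :=
  fun u v ↦ by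
    rw [h]
    simp only [neg_apply]
    module

lemma IsProjectiveChange.covDeriv_exp_smul (h : IsProjectiveChange a b ψ y) {Ψ : E → ℝ}
    (hΨ : HasFDerivAt Ψ ψ y) {X : E → E} (hX : DifferentiableAt ℝ X y) {ρ : ℝ}
    (hρ : covDeriv a X y = ρ • ContinuousLinearMap.id ℝ E) :
    covDeriv b (fun z ↦ Real.exp (-Ψ z) • X z) y =
      (Real.exp (-Ψ y) * (ρ + ψ (X y))) • ContinuousLinearMap.id ℝ E := by
  ext u
  have hexp := hΨ.fun_neg.exp
  have hcov : covDeriv b X y u = ρ • u + ψ u • X y + ψ (X y) • u := by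
    have hρu := DFunLike.congr_fun hρ u
    rw [covDeriv_apply] at hρu ⊢
    rw [h, ← add_assoc, ← add_assoc, hρu]
    simp
  rw [covDeriv_smul hexp.differentiableAt hX, hexp.fderiv, hcov]
  simp
  module

lemma fderiv_det_comp [FiniteDimensional ℝ E] {C : E → E →L[ℝ] E}
    (hC : DifferentiableAt ℝ C y) (hinv : (C y).IsInvertible) (u : E) :
    fderiv ℝ (fun z ↦ (C z).det) y u =
      (C y).det * LinearMap.trace ℝ E ((C y).inverse.comp (covDerivEnd b C y u)) := by
  have hchain := ((contDiff_det (E := E)).differentiable (by simp) (C y)).hasFDerivAt.comp y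
    hC.hasFDerivAt
  have hcov : (C y).inverse.comp (covDerivEnd b C y u) = (C y).inverse.comp (fderiv ℝ C y u)
      + (C y).inverse.comp ((connection b y u).comp (C y)) - connection b y u := by
    rw [covDerivEnd, ContinuousLinearMap.comp_sub, ContinuousLinearMap.comp_add,
      ← ContinuousLinearMap.comp_assoc (C y).inverse (C y), hinv.inverse_comp_self,
      ContinuousLinearMap.id_comp]
  calc fderiv ℝ (fun z ↦ (C z).det) y u
      = (C y).det * LinearMap.trace ℝ E ((C y).inverse.comp (fderiv ℝ C y u)) := by
        rw [← fderiv_det hinv]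
        exact DFunLike.congr_fun hchain.fderiv u
    _ = _ := by
        rw [hcov, ContinuousLinearMap.toLinearMap_sub, ContinuousLinearMap.toLinearMap_add, map_sub,
          map_add, trace_inverse_comp_comp hinv, add_sub_cancel_right]

end ProjectiveChange

section ProjectiveChange

variable {E : Type*} [NormedAddCommGroup E] [NormedSpace ℝ E] [FiniteDimensional ℝ E]
  {a b : E → E →L[ℝ] E →L[ℝ] ℝ} {D : Set E} {y : E} {ψ : E →L[ℝ] ℝ}

namespace IsMetricOn

lemma formRatio_isInvertible (ha : IsMetricOn a D) (hb : IsMetricOn b D) (hy : y ∈ D) :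
    (formRatio (a y) (b y)).IsInvertible :=
  (ha.isInvertible hy).inverse.comp (hb.isInvertible hy)

lemma contDiffOn_formRatio (ha : IsMetricOn a D) (hb : IsMetricOn b D) :
    ContDiffOn ℝ ∞ (fun z ↦ formRatio (a z) (b z)) D :=
  ha.inverse_contDiffOn.clm_comp hb.contDiffOn

lemma contDiffOn_volumePotential (ha : IsMetricOn a D) (hb : IsMetricOn b D) :
    ContDiffOn ℝ ∞ (fun z ↦ volumePotential (a z) (b z)) D :=
  contDiffOn_const.mul (ContDiffOn.log (contDiff_det.comp_contDiffOn (ha.contDiffOn_formRatio hb))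
    fun _ hy ↦ det_ne_zero_of_isInvertible (ha.formRatio_isInvertible hb hy))

-- Differentiate `a (C v, w) = b (v, w)` along the connection of `b`.
lemma covDerivEnd_formRatio (ha : IsMetricOn a D) (hb : IsMetricOn b D) (hy : y ∈ D)
    (hψ : IsProjectiveChange a b ψ y) (u v : E) :
    covDerivEnd b (fun z ↦ formRatio (a z) (b z)) y u v =
      (2 * ψ u) • formRatio (a y) (b y) v + ψ (formRatio (a y) (b y) v) • u
        + b y u v • (a y).inverse ψ := by
  set C := fun z ↦ formRatio (a z) (b z)
  have hC : DifferentiableAt ℝ C y :=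
    differentiableAt_of_contDiffOn (ha.contDiffOn_formRatio hb) ha.isOpen hy
  have haC {z : E} (hz : z ∈ D) (v w : E) : a z (C z v) w = b z v w := by
    rw [formRatio_apply (ha.isInvertible hz)]
  refine ha.ext hy fun w ↦ ?_
  have heq : (fun z ↦ a z (C z v) w) =ᶠ[nhds y] fun z ↦ b z v w :=
    Filter.eventually_of_mem (ha.isOpen.mem_nhds hy) fun z hz ↦ haC hz v w
  have hderiv := DFunLike.congr_fun (heq.fderiv_eq (𝕜 := ℝ)) u
  rw [fderiv_bilin_apply_apply (ha.differentiableAt hy) (hC.clm_apply (differentiableAt_const v))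
    (differentiableAt_const w), fderiv_bilin_apply_apply (hb.differentiableAt hy)
    (differentiableAt_const v) (differentiableAt_const w),
    fderiv_clm_apply_apply hC (differentiableAt_const v), ha.fderiv_eq hy, hb.fderiv_eq hy,
    ← haC hy (connection b y u v), ← haC hy v (connection b y u w), hψ u w] at hderiv
  simp only [fderiv_fun_const, Pi.zero_apply, zero_apply, map_zero, add_zero, map_add, map_smul,
    smul_eq_mul, haC hy v u] at hderiv
  rw [covDerivEnd_apply, hψ u (C y v), hb.symm y hy u v]
  simp only [map_add, map_sub, map_smul, add_apply, sub_apply, smul_apply, smul_eq_mul,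
    (ha.isInvertible hy).self_apply_inverse]
  linear_combination hderiv

lemma trace_formRatio_covDerivEnd (ha : IsMetricOn a D) (hb : IsMetricOn b D) (hy : y ∈ D)
    (hψ : IsProjectiveChange a b ψ y) (u : E) :
    LinearMap.trace ℝ E ((formRatio (a y) (b y)).inverse.comp
      (covDerivEnd b (fun z ↦ formRatio (a z) (b z)) y u)) =
      2 * (Module.finrank ℝ E + 1) * ψ u := by
  set C := formRatio (a y) (b y)
  have hinv : C.IsInvertible := ha.formRatio_isInvertible hb hy
  have hcov : (C.inverse.comp (covDerivEnd b (fun z ↦ formRatio (a z) (b z)) y u) : E →ₗ[ℝ] E) =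
      (2 * ψ u) • LinearMap.id + (ψ.comp C : E →ₗ[ℝ] ℝ).smulRight (C.inverse u)
        + (b y u : E →ₗ[ℝ] ℝ).smulRight (C.inverse ((a y).inverse ψ)) := by
    ext v
    simp [ha.covDerivEnd_formRatio hb hy hψ, C, hinv.inverse_apply_self]
  have hgrad : b y u (C.inverse ((a y).inverse ψ)) = ψ u := by
    rw [hb.symm y hy, ← formRatio_apply (ha.isInvertible hy), hinv.self_apply_inverse,
      (ha.isInvertible hy).self_apply_inverse]
  rw [hcov, map_add, map_add, map_smul, LinearMap.trace_id, LinearMap.trace_smulRight,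
    LinearMap.trace_smulRight]
  simp [hinv.self_apply_inverse, hgrad]
  ring

lemma hasFDerivAt_volumePotential (ha : IsMetricOn a D) (hb : IsMetricOn b D) (hy : y ∈ D)
    (hψ : IsProjectiveChange a b ψ y) :
    HasFDerivAt (fun z ↦ volumePotential (a z) (b z)) ψ y := by
  have hinv := ha.formRatio_isInvertible hb hy
  have hdet := det_ne_zero_of_isInvertible hinv
  have hC := differentiableAt_of_contDiffOn (ha.contDiffOn_formRatio hb) ha.isOpen hy
  have hlog := (((contDiff_det.differentiable (by simp) _).comp y hC).hasFDerivAt.log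
    hdet).const_mul (2 * (Module.finrank ℝ E + 1 : ℝ))⁻¹
  refine hlog.congr_fderiv (ContinuousLinearMap.ext fun u ↦ ?_)
  have hn : (Module.finrank ℝ E + 1 : ℝ) ≠ 0 := by positivity
  have hjacobi := fderiv_det_comp (b := b) hC hinv u
  rw [ha.trace_formRatio_covDerivEnd hb hy hψ] at hjacobi
  simp only [smul_apply, smul_eq_mul]
  rw [show fderiv ℝ ((fun C : E →L[ℝ] E ↦ C.det) ∘ fun z ↦ formRatio (a z) (b z)) y u = _
    from hjacobi]
  simp only [Function.comp_apply]
  field_simp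

end IsMetricOn

lemma isSinyukovOn_formRatio (ha : IsMetricOn a D) (hb : IsMetricOn b D) {Ψ : E → ℝ}
    (hψ : ∀ y ∈ D, IsProjectiveChange a b (fderiv ℝ Ψ y) y) (hΨ : ContDiffOn ℝ ∞ Ψ D) :
    IsSinyukovOn b (fun y ↦ Real.exp (-2 * Ψ y) • formRatio (a y) (b y))
      (fun y ↦ Real.exp (-2 * Ψ y) • (a y).inverse (fderiv ℝ Ψ y)) D where
  contDiffOn_end := (contDiffOn_const.mul hΨ).exp.smul (ha.contDiffOn_formRatio hb)
  contDiffOn_field := (contDiffOn_const.mul hΨ).exp.smul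
    (ha.inverse_contDiffOn.clm_apply (hΨ.fderiv_of_isOpen ha.isOpen (by simp)))
  self_adjoint y hy v w := by
    have hab (v w : E) : b y v w = a y (formRatio (a y) (b y) v) w := by
      rw [formRatio_apply (ha.isInvertible hy)]
    simp only [smul_apply, map_smul, smul_eq_mul]
    rw [hb.symm y hy, hab w, hab v, ha.symm y hy]
  covDerivEnd_apply y hy u v := by
    have hΨy := differentiableAt_of_contDiffOn hΨ ha.isOpen hy
    have hexp := (hΨy.hasFDerivAt.const_mul (-2)).exp
    have hC := differentiableAt_of_contDiffOn (ha.contDiffOn_formRatio hb) ha.isOpen hy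
    have hgrad : b y ((a y).inverse (fderiv ℝ Ψ y)) v =
        fderiv ℝ Ψ y (formRatio (a y) (b y) v) := by
      rw [hb.symm y hy, ← formRatio_apply (ha.isInvertible hy), ha.symm y hy,
        (ha.isInvertible hy).self_apply_inverse]
    rw [covDerivEnd_smul hexp.differentiableAt hC, hexp.fderiv]
    simp only [add_apply, smul_apply]
    rw [ha.covDerivEnd_formRatio hb hy (hψ y hy), map_smul, smul_apply, hgrad]
    simp only [smul_eq_mul]
    module

end ProjectiveChange

section SelfAdjoint

variable {E : Type*} [NormedAddCommGroup E] [NormedSpace ℝ E] {B : E →L[ℝ] E →L[ℝ] ℝ}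

lemma form_eq_zero_of_bilin_identity (hsymm : ∀ v w, B v w = B w v)
    (hnd : ∀ v, (∀ w, B v w = 0) → v = 0) {N : E → E} {P : E}
    (h : ∀ z v, B z v • N P + B (N P) v • z = B P v • N z + B (N z) v • P) {x : E}
    (hx : B P x = 0) : B (N P) x = 0 := by
  by_cases hx0 : x = 0
  · simp [hx0]
  obtain ⟨z, hz⟩ : ∃ z, B x z ≠ 0 := by
    by_contra! hc
    exact hx0 (hnd x hc)
  have hzx := congrArg (fun t ↦ B t x) (h z x)
  simp only [map_add, map_smul, add_apply, smul_apply, smul_eq_mul, hx, hsymm z x] at hzx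
  exact (mul_eq_zero.1 (show B x z * B (N P) x = 0 by linarith)).resolve_left hz

lemma exists_eq_smul_of_bilin_identity (hsymm : ∀ v w, B v w = B w v)
    (hnd : ∀ v, (∀ w, B v w = 0) → v = 0) {N : E → E} {P : E} (hP : P ≠ 0)
    (h : ∀ z v, B z v • N P + B (N P) v • z = B P v • N z + B (N z) v • P) :
    ∃ μ : ℝ, ∀ u, N u = μ • u := by
  obtain ⟨w, hw⟩ : ∃ w, B P w ≠ 0 := by
    by_contra! hc
    exact hP (hnd P hc)
  obtain ⟨Y, hY⟩ : ∃ Y, B P Y = 1 := ⟨(B P w)⁻¹ • w, by simp [hw]⟩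
  set μ := B (N P) Y
  have hNP : N P = μ • P := by
    refine sub_eq_zero.1 (hnd _ fun x ↦ ?_)
    have hproj := form_eq_zero_of_bilin_identity hsymm hnd h (x := x - B P x • Y) (by simp [hY])
    simp only [map_sub, map_smul, sub_apply, smul_apply, smul_eq_mul] at hproj ⊢
    linear_combination hproj
  refine ⟨μ, fun z ↦ ?_⟩
  have hzY := h z Y
  rw [hY, hNP] at hzY
  have hNz : B (N z) Y = B z Y * μ := by
    have hform := congrArg (fun t ↦ B t Y) hzY
    simp only [map_add, map_smul, add_apply, smul_apply, smul_eq_mul, hY] at hform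
    linarith
  rw [hNz, map_smul, smul_apply, hY] at hzY
  linear_combination (norm := module) -hzY

lemma exists_preimage_mem_ker {K V : Type*} [Field K] [AddCommGroup V] [Module K V]
    [FiniteDimensional K V] {A : V →ₗ[K] V} (hA : Function.Injective A) {φ : V →ₗ[K] K} {P : V}
    (h : ∀ m, φ ((A ^ m) P) = 0) : ∃ w, A w = P ∧ φ w = 0 := by
  let S : Submodule K V := Submodule.span K (Set.range fun m ↦ (A ^ m) P)
  have hS : S ≤ LinearMap.ker φ := Submodule.span_le.2 (by rintro _ ⟨m, rfl⟩; exact h m)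
  have hAS : ∀ w ∈ S, A w ∈ S := by
    change S ≤ S.comap A
    refine Submodule.span_le.2 ?_
    rintro _ ⟨m, rfl⟩
    exact Submodule.subset_span ⟨m + 1, by simp [pow_succ']⟩
  have hinj : Function.Injective (A.restrict hAS) := fun v w hvw ↦
    Subtype.ext (hA (congrArg Subtype.val hvw))
  obtain ⟨w, hw⟩ := LinearMap.injective_iff_surjective.1 hinj
    ⟨P, Submodule.subset_span ⟨0, by simp⟩⟩
  exact ⟨w, congrArg Subtype.val hw, hS w.2⟩

lemma form_pow_apply {A : E →L[ℝ] E} (hA : ∀ v w, B (A v) w = B v (A w)) (k : ℕ) (v w : E) :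
    B ((A ^ k) v) w = B v ((A ^ k) w) := by
  induction k generalizing v with
  | zero => rfl
  | succ k ih =>
    simp only [pow_succ, mul_apply_eq_comp]
    rw [ih, hA, ← mul_apply_eq_comp, ← mul_apply_eq_comp,
      ← pow_succ', ← pow_succ]

end SelfAdjoint

section Sinyukov

variable {E : Type*} [NormedAddCommGroup E] [NormedSpace ℝ E]
  {b : E → E →L[ℝ] E →L[ℝ] ℝ} {D : Set E} {y : E} {A : E → E →L[ℝ] E} {l P : E → E}

lemma contDiffOn_pow_apply (hA : ContDiffOn ℝ ∞ A D) (hP : ContDiffOn ℝ ∞ P D) (k : ℕ) :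
    ContDiffOn ℝ ∞ (fun z ↦ (A z ^ k) (P z)) D := by
  induction k with
  | zero => simpa using hP
  | succ k ih => simpa [pow_succ'] using hA.clm_apply ih

namespace IsSinyukovOn

lemma covDeriv_apply (hS : IsSinyukovOn b A l D) (hD : IsOpen D) (hy : y ∈ D) {X : E → E}
    (hX : DifferentiableAt ℝ X y) (u : E) :
    covDeriv b (fun z ↦ A z (X z)) y u =
      b y u (X y) • l y + b y (l y) (X y) • u + A y (covDeriv b X y u) := by
  rw [covDeriv_clm_apply (differentiableAt_of_contDiffOn hS.contDiffOn_end hD hy) hX,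
    hS.covDerivEnd_apply y hy]

lemma covDeriv_pow_apply (hS : IsSinyukovOn b A l D) (hD : IsOpen D) (hy : y ∈ D)
    (hP : ContDiffOn ℝ ∞ P D) (hpar : covDeriv b P y = 0) (k : ℕ) (u : E) :
    covDeriv b (fun z ↦ (A z ^ k) (P z)) y u = ∑ i ∈ Finset.range k,
      (b y u ((A y ^ i) (P y)) • (A y ^ (k - 1 - i)) (l y)
        + b y (l y) ((A y ^ i) (P y)) • (A y ^ (k - 1 - i)) u) := by
  induction k with
  | zero => simp [hpar]
  | succ k ih =>
    have hk := differentiableAt_of_contDiffOn (contDiffOn_pow_apply hS.contDiffOn_end hP k) hD hy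
    simp only [pow_succ' _ k, mul_apply_eq_comp]
    rw [hS.covDeriv_apply hD hy hk, ih, map_sum, Finset.sum_range_succ, add_comm]
    congr 1
    · refine Finset.sum_congr rfl fun i hi ↦ ?_
      obtain ⟨j, rfl⟩ := Nat.exists_eq_add_of_lt (Finset.mem_range.1 hi)
      simp only [map_add, map_smul, ← mul_apply_eq_comp, ← pow_succ']
      congr! 4 <;> omega
    · simp

section Moments

variable (hS : IsSinyukovOn b A l D) (hb : IsMetricOn b D) (hy : y ∈ D)
  (hP : ContDiffOn ℝ ∞ P D) (hPpar : covDeriv b P y = 0) (hlpar : covDeriv b l y = 0) {m : ℕ}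
  (hlP : ∀ j < m, b y (l y) ((A y ^ j) (P y)) = 0)

include hS hb hy hP hPpar hlP in
lemma covDeriv_pow_apply_of_moments (u : E) :
    covDeriv b (fun z ↦ (A z ^ m) (P z)) y u =
      ∑ i ∈ Finset.range m, b y u ((A y ^ i) (P y)) • (A y ^ (m - 1 - i)) (l y) := by
  rw [hS.covDeriv_pow_apply hb.isOpen hy hP hPpar]
  refine Finset.sum_congr rfl fun i hi ↦ ?_
  rw [hlP i (Finset.mem_range.1 hi), zero_smul, add_zero]

variable [FiniteDimensional ℝ E]

include hS hb hy hP hPpar hlpar hlP in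
lemma fderiv_moment (hll : ∀ j < m, b y (l y) ((A y ^ j) (l y)) = 0) :
    fderiv ℝ (fun z ↦ b z (l z) ((A z ^ m) (P z))) y = 0 := by
  ext u
  rw [hb.fderiv_form_apply hy (differentiableAt_of_contDiffOn hS.contDiffOn_field hb.isOpen hy)
    (differentiableAt_of_contDiffOn (contDiffOn_pow_apply hS.contDiffOn_end hP m) hb.isOpen hy),
    hS.covDeriv_pow_apply_of_moments hb hy hP hPpar hlP, hlpar, map_sum]
  simp only [zero_apply, map_zero, zero_add, map_smul]
  refine Finset.sum_eq_zero fun i hi ↦ ?_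
  rw [hll _ (by have := Finset.mem_range.1 hi; omega), smul_zero]

include hS hb hy hP hPpar hlP in
lemma fderiv_form_pow_succ (u : E) :
    fderiv ℝ (fun z ↦ b z ((A z ^ (m + 1)) (P z)) (P z)) y u =
      2 * b y (l y) ((A y ^ m) (P y)) * b y u (P y) := by
  have hpow := contDiffOn_pow_apply hS.contDiffOn_end hP
  have hsa := form_pow_apply (hS.self_adjoint y hy)
  rw [hb.fderiv_form_apply hy (differentiableAt_of_contDiffOn (hpow (m + 1)) hb.isOpen hy)
    (differentiableAt_of_contDiffOn hP hb.isOpen hy), hPpar,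
    hS.covDeriv_pow_apply hb.isOpen hy hP hPpar]
  set f : ℕ → ℝ := fun i ↦ b y (l y) ((A y ^ i) (P y)) * b y u ((A y ^ (m - i)) (P y))
  have hsum : ∑ i ∈ Finset.range (m + 1), f i = b y (l y) ((A y ^ m) (P y)) * b y u (P y) := by
    rw [Finset.sum_range_succ, Finset.sum_eq_zero fun i hi ↦ by
      simp only [f, hlP i (Finset.mem_range.1 hi), zero_mul]]
    simp [f]
  calc _ = ∑ i ∈ Finset.range (m + 1), (f (m + 1 - 1 - i) + f i) := by
        simp only [map_sum, map_add, map_smul, sum_apply, add_apply, smul_apply, smul_eq_mul,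
          zero_apply, map_zero, add_zero, hsa]
        refine Finset.sum_congr rfl fun i hi ↦ ?_
        have hi := Finset.mem_range_succ_iff.1 hi
        simp only [f, Nat.add_sub_cancel, Nat.sub_sub_self hi]
        ring
    _ = _ := by
        rw [Finset.sum_add_distrib, Finset.sum_range_reflect, hsum]
        ring

-- For `m = 0` this is a multiple of the identity; for `m > 0` it vanishes.
include hS hb hy hP hPpar hlpar hlP in
lemma covDeriv_moment_combination (hll : ∀ j < m, b y (l y) ((A y ^ j) (l y)) = 0) :
    covDeriv b (fun z ↦ (2 * b z (l z) ((A z ^ m) (P z))) • A z (P z)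
        - b z ((A z ^ (m + 1)) (P z)) (P z) • l z) y =
      (2 * b y (l y) ((A y ^ m) (P y)) * b y (l y) (P y)) • ContinuousLinearMap.id ℝ E := by
  have hdb := hb.differentiableAt hy
  have hdA := differentiableAt_of_contDiffOn hS.contDiffOn_end hb.isOpen hy
  have hdl := differentiableAt_of_contDiffOn hS.contDiffOn_field hb.isOpen hy
  have hdP := differentiableAt_of_contDiffOn hP hb.isOpen hy
  have hdpow (k : ℕ) := differentiableAt_of_contDiffOn
    (contDiffOn_pow_apply hS.contDiffOn_end hP k) hb.isOpen hy
  have hdG := ((hdb.clm_apply hdl).clm_apply (hdpow m)).const_mul 2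
  have hdF := (hdb.clm_apply (hdpow (m + 1))).clm_apply hdP
  ext u
  rw [covDeriv_sub (hdG.fun_smul (hdA.clm_apply hdP)) (hdF.fun_smul hdl), sub_apply,
    covDeriv_smul hdG (hdA.clm_apply hdP), covDeriv_smul hdF hdl,
    hS.covDeriv_apply hb.isOpen hy hdP, hS.fderiv_form_pow_succ hb hy hP hPpar hlP,
    fderiv_const_mul ((hdb.clm_apply hdl).clm_apply (hdpow m)),
    hS.fderiv_moment hb hy hP hPpar hlpar hlP hll, hPpar, hlpar]
  simp only [smul_apply, zero_apply, map_zero, smul_zero, zero_smul]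
  simp
  module

end Moments

variable [FiniteDimensional ℝ E]

-- The Ricci identity for the fields `v` and `A v` with `v` constant.
lemma curvature_commutator (hS : IsSinyukovOn b A l D) (hb : IsMetricOn b D) (hy : y ∈ D)
    (x z v : E) :
    curvature b y x z (A y v) - A y (curvature b y x z v) =
      b y z v • covDeriv b l y x + b y (covDeriv b l y x) v • z
        - b y x v • covDeriv b l y z - b y (covDeriv b l y z) v • x := by
  have hconst : ContDiffOn ℝ ∞ (fun _ ↦ v : E → E) D := contDiffOn_const
  have hdb := hb.differentiableAt hy
  have hdl := differentiableAt_of_contDiffOn hS.contDiffOn_field hb.isOpen hy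
  have hdA := differentiableAt_of_contDiffOn hS.contDiffOn_end hb.isOpen hy
  have second (x z : E) : covDeriv b (fun w ↦ covDeriv b (fun p ↦ A p v) w z) y x =
      (b y (connection b y x z) v + b y z (connection b y x v)) • l y
        + b y z v • covDeriv b l y x
        + ((b y (covDeriv b l y x) v + b y (l y) (connection b y x v)) • z
        + b y (l y) v • connection b y x z)
        + (b y x (connection b y z v) • l y + b y (l y) (connection b y z v) • x
        + A y (covDeriv b (fun w ↦ covDeriv b (fun _ ↦ v) w z) y x)) := by
    have hfst : (fun w ↦ covDeriv b (fun p ↦ A p v) w z) =ᶠ[nhds y] fun w ↦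
        b w z v • l w + b w (l w) v • z + A w (covDeriv b (fun _ ↦ v) w z) :=
      Filter.eventually_of_mem (hb.isOpen.mem_nhds hy) fun w hw ↦
        hS.covDeriv_apply hb.isOpen hw (differentiableAt_const v) z
    have hcov (x z : E) : covDeriv b (fun _ ↦ z) y x = connection b y x z := by
      simp [_root_.covDeriv_apply]
    have hbz := (hdb.clm_apply (differentiableAt_const z)).clm_apply (differentiableAt_const v)
    have hbl := (hdb.clm_apply hdl).clm_apply (differentiableAt_const v)
    have hdv := hb.covDeriv_differentiableAt hy hconst z
    rw [covDeriv_congr hfst, covDeriv_add ((hbz.fun_smul hdl).fun_add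
      (hbl.fun_smul (differentiableAt_const z))) (hdA.clm_apply hdv),
      covDeriv_add (hbz.fun_smul hdl) (hbl.fun_smul (differentiableAt_const z)), add_apply,
      add_apply, covDeriv_smul hbz hdl, covDeriv_smul hbl (differentiableAt_const z),
      hb.fderiv_form_apply hy (differentiableAt_const z) (differentiableAt_const v),
      hb.fderiv_form_apply hy hdl (differentiableAt_const v), hS.covDeriv_apply hb.isOpen hy hdv]
    simp only [hcov]
  rw [← hb.covDeriv_covDeriv_sub hy (hS.contDiffOn_end.clm_apply contDiffOn_const),
    ← hb.covDeriv_covDeriv_sub hy hconst, second, second, map_sub, hb.connection_symm hy x z]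
  module

-- The curvature annihilates the parallel field, which kills the left side of the commutator.
lemma exists_covDeriv_eq_smul (hS : IsSinyukovOn b A l D) (hb : IsMetricOn b D) (hy : y ∈ D)
    (hP : ContDiffOn ℝ ∞ P D) (hpar : ∀ w ∈ D, covDeriv b P w = 0) (hP0 : P y ≠ 0) :
    ∃ μ : ℝ, covDeriv b l y = μ • ContinuousLinearMap.id ℝ E := by
  obtain ⟨μ, hμ⟩ := exists_eq_smul_of_bilin_identity (hb.symm y hy) (hb.nondegenerate y hy)
    (N := covDeriv b l y) hP0 fun z v ↦ by
      have h := hS.curvature_commutator hb hy (P y) z v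
      rw [hb.curvature_parallel_left hy hP hpar, hb.curvature_parallel_left hy hP hpar,
        map_zero] at h
      linear_combination (norm := module) -h
  exact ⟨μ, ContinuousLinearMap.ext hμ⟩

end IsSinyukovOn

end Sinyukov

section Polarization

variable {K V : Type*} [Field K] [AddCommGroup V] [Module K V] {T : V →ₗ[K] V →ₗ[K] V}
  {κ : V → K}

lemma quadratic_eigenvalue_smul (h0 : κ 0 = 0) (hκ : ∀ u, T u u = κ u • u) (c : K) (u : V) :
    κ (c • u) = c * κ u := by
  obtain rfl | hu := eq_or_ne u 0
  · simp [h0]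
  obtain rfl | hc := eq_or_ne c 0
  · simp [h0]
  have hcu := hκ (c • u)
  simp only [map_smul, LinearMap.smul_apply, hκ u, smul_smul] at hcu
  refine mul_left_cancel₀ hc ?_
  linear_combination -smul_left_injective K hu hcu

variable [NeZero (2 : K)]

lemma quadratic_eigenvalue_add (hT : ∀ u v, T u v = T v u) (h0 : κ 0 = 0)
    (hκ : ∀ u, T u u = κ u • u) (u v : V) : κ (u + v) = κ u + κ v := by
  obtain rfl | hu := eq_or_ne u 0
  · simp [h0]
  by_cases hv : ∃ c : K, c • u = v
  · obtain ⟨c, rfl⟩ := hv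
    rw [show u + c • u = (1 + c) • u by module, quadratic_eigenvalue_smul h0 hκ,
      quadratic_eigenvalue_smul h0 hκ]
    ring
  · have hadd := hκ (u + v)
    have hsub := hκ (u - v)
    simp only [map_add, map_sub, LinearMap.add_apply, LinearMap.sub_apply, hκ u, hκ v, hT v u]
      at hadd hsub
    have hzero : (κ (u + v) + κ (u - v) - 2 * κ u) • u
        + (κ (u + v) - κ (u - v) - 2 * κ v) • v = 0 := by
      linear_combination (norm := module) -hadd - hsub
    obtain ⟨hku, hkv⟩ := LinearIndependent.pair_iff.1
      ((LinearIndependent.pair_iff' hu).2 fun c hc ↦ hv ⟨c, hc⟩) _ _ hzero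
    exact mul_left_cancel₀ (NeZero.ne (2 : K)) (by linear_combination hku + hkv)

lemma exists_oneForm_of_forall_eq_smul (hT : ∀ u v, T u v = T v u)
    (h : ∀ u, u ≠ 0 → ∃ κ : K, T u u = κ • u) :
    ∃ ψ : V →ₗ[K] K, ∀ u v, T u v = ψ u • v + ψ v • u := by
  have hex (u : V) : ∃ κ : K, T u u = κ • u ∧ (u = 0 → κ = 0) := by
    obtain rfl | hu := eq_or_ne u 0
    · exact ⟨0, by simp⟩
    · obtain ⟨κ, hκ⟩ := h u hu
      exact ⟨κ, hκ, fun h ↦ absurd h hu⟩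
  choose κ hκ hκ0 using hex
  have hadd := quadratic_eigenvalue_add hT (hκ0 0 rfl) hκ
  refine ⟨(2 : K)⁻¹ • ⟨⟨κ, hadd⟩, quadratic_eigenvalue_smul (hκ0 0 rfl) hκ⟩, fun u v ↦ ?_⟩
  have huv := hκ (u + v)
  simp only [map_add, LinearMap.add_apply, hκ u, hκ v, hT v u, hadd] at huv
  have htwo : (2 : K) • T u v = κ u • v + κ v • u := by
    linear_combination (norm := module) huv
  refine smul_right_injective V (NeZero.ne (2 : K)) (htwo.trans ?_)
  simp [smul_smul, NeZero.ne (2 : K)]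

end Polarization

section ChangeOfCoordinates

variable {E : Type*} [NormedAddCommGroup E] [NormedSpace ℝ E]
  {b b' : E → E →L[ℝ] E →L[ℝ] ℝ} {D D' : Set E} {y : E} {τ : E → E}

/-- `τ` is a smooth local isometry from the metric `b` on the open set `D` to the metric `b'`
on `D'`. -/
structure IsIsometryOn (τ : E → E) (b b' : E → E →L[ℝ] E →L[ℝ] ℝ) (D D' : Set E) : Prop where
  source : IsMetricOn b D
  target : IsMetricOn b' D'
  contDiffOn : ContDiffOn ℝ ∞ τ D
  mapsTo : Set.MapsTo τ D D'
  form_apply : ∀ z ∈ D, ∀ v w, b z v w = b' (τ z) (fderiv ℝ τ z v) (fderiv ℝ τ z w)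

/-- The acceleration `∇_{x'} x'` of the curve `x` with respect to `b`. -/
def acceleration (b : E → E →L[ℝ] E →L[ℝ] ℝ) (x : ℝ → E) (t : ℝ) : E :=
  deriv (deriv x) t + connection b (x t) (deriv x t) (deriv x t)

namespace IsIsometryOn

lemma differentiableAt (h : IsIsometryOn τ b b' D D') (hy : y ∈ D) : DifferentiableAt ℝ τ y :=
  differentiableAt_of_contDiffOn h.contDiffOn h.source.isOpen hy

lemma differentiableAt_fderiv (h : IsIsometryOn τ b b' D D') (hy : y ∈ D) :
    DifferentiableAt ℝ (fderiv ℝ τ) y :=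
  differentiableAt_fderiv_of_contDiffOn h.contDiffOn h.source.isOpen hy

lemma fderiv_injective (h : IsIsometryOn τ b b' D D') (hy : y ∈ D) :
    Function.Injective (fderiv ℝ τ y) := by
  refine (injective_iff_map_eq_zero _).2 fun v hv ↦ h.source.nondegenerate y hy v fun w ↦ ?_
  rw [h.form_apply y hy, hv, map_zero, zero_apply]

variable [FiniteDimensional ℝ E]

lemma fderiv_form (h : IsIsometryOn τ b b' D D') (hy : y ∈ D) (u v w : E) :
    fderiv ℝ b y u v w =
      b' (τ y) (connection b' (τ y) (fderiv ℝ τ y u) (fderiv ℝ τ y v)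
        + fderiv ℝ (fderiv ℝ τ) y u v) (fderiv ℝ τ y w)
      + b' (τ y) (fderiv ℝ τ y v) (connection b' (τ y) (fderiv ℝ τ y u) (fderiv ℝ τ y w)
        + fderiv ℝ (fderiv ℝ τ) y u w) := by
  have hd := h.differentiableAt hy
  have hd2 := h.differentiableAt_fderiv hy
  have hb' := h.target.differentiableAt (h.mapsTo hy)
  have hv := differentiableAt_const (𝕜 := ℝ) (x := y) v
  have hw := differentiableAt_const (𝕜 := ℝ) (x := y) w
  have heq : (fun z ↦ b z v w) =ᶠ[nhds y] fun z ↦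
      b' (τ z) (fderiv ℝ τ z v) (fderiv ℝ τ z w) :=
    Filter.eventually_of_mem (h.source.isOpen.mem_nhds hy) fun z hz ↦ h.form_apply z hz v w
  have hderiv := DFunLike.congr_fun (heq.fderiv_eq (𝕜 := ℝ)) u
  rw [fderiv_bilin_apply_apply (h.source.differentiableAt hy) hv hw,
    fderiv_bilin_apply_apply (c := fun z ↦ b' (τ z)) (hb'.comp y hd) (hd2.clm_apply hv)
      (hd2.clm_apply hw), fderiv_clm_apply_apply hd2 hv, fderiv_clm_apply_apply hd2 hw,
    show (fun z ↦ b' (τ z)) = b' ∘ τ from rfl, fderiv_comp y hb' hd,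
    ContinuousLinearMap.comp_apply, h.target.fderiv_eq (h.mapsTo hy)] at hderiv
  simp only [fderiv_fun_const, Pi.zero_apply, zero_apply, map_zero, add_zero] at hderiv
  rw [hderiv]
  simp only [map_add, add_apply]
  ring

lemma fderiv_connection (h : IsIsometryOn τ b b' D D') (hy : y ∈ D) (u v : E) :
    fderiv ℝ τ y (connection b y u v) =
      connection b' (τ y) (fderiv ℝ τ y u) (fderiv ℝ τ y v) + fderiv ℝ (fderiv ℝ τ) y u v := by
  have hsurj : Function.Surjective (fderiv ℝ τ y) :=
    LinearMap.injective_iff_surjective (f := (fderiv ℝ τ y : E →ₗ[ℝ] E)).1 (h.fderiv_injective hy)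
  choose S hS using hsurj
  have hd2 := h.differentiableAt_fderiv hy
  have hsymm (u v : E) : fderiv ℝ (fderiv ℝ τ) y u v = fderiv ℝ (fderiv ℝ τ) y v u := by
    simpa [fderiv_clm_apply_apply hd2 (differentiableAt_const _)] using
      fderiv_fderiv_comm h.contDiffOn h.source.isOpen hy u v
  rw [h.source.connection_unique hy (fun u v ↦ S (connection b' (τ y) (fderiv ℝ τ y u)
    (fderiv ℝ τ y v) + fderiv ℝ (fderiv ℝ τ) y u v)) ?_ ?_, hS]
  · intro u v
    rw [h.target.connection_symm (h.mapsTo hy), hsymm]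
  · intro u v w
    rw [h.form_apply y hy, h.form_apply y hy, hS, hS, h.fderiv_form hy]

lemma fderiv_covDeriv (h : IsIsometryOn τ b b' D D') (hy : y ∈ D) {X X' : E → E}
    (hX : DifferentiableAt ℝ X y) (hX' : DifferentiableAt ℝ X' (τ y))
    (hXX' : ∀ z ∈ D, X' (τ z) = fderiv ℝ τ z (X z)) (u : E) :
    fderiv ℝ τ y (covDeriv b X y u) = covDeriv b' X' (τ y) (fderiv ℝ τ y u) := by
  have heq : X' ∘ τ =ᶠ[nhds y] fun z ↦ fderiv ℝ τ z (X z) :=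
    Filter.eventually_of_mem (h.source.isOpen.mem_nhds hy) hXX'
  have hderiv := DFunLike.congr_fun (heq.fderiv_eq (𝕜 := ℝ)) u
  rw [fderiv_comp y hX' (h.differentiableAt hy), ContinuousLinearMap.comp_apply,
    fderiv_clm_apply_apply (h.differentiableAt_fderiv hy) hX] at hderiv
  rw [covDeriv_apply, covDeriv_apply, map_add, h.fderiv_connection hy, hXX' y hy, hderiv]
  abel

lemma fderiv_acceleration (h : IsIsometryOn τ b b' D D') {x : ℝ → E} {t : ℝ} (ht : x t ∈ D)
    (hx : ContDiffAt ℝ ∞ x t) :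
    fderiv ℝ τ (x t) (acceleration b x t) = acceleration b' (τ ∘ x) t := by
  have hdx : ∀ᶠ s in nhds t, HasDerivAt x (deriv x s) s := by
    filter_upwards [(hx.of_le (m := 1) (by simp)).eventually (by simp)] with s hs
    exact (hs.differentiableAt (by simp)).hasDerivAt
  have hxD : ∀ᶠ s in nhds t, x s ∈ D :=
    hx.continuousAt.preimage_mem_nhds (h.source.isOpen.mem_nhds ht)
  have hfst : deriv (τ ∘ x) =ᶠ[nhds t] fun s ↦ fderiv ℝ τ (x s) (deriv x s) := by
    filter_upwards [hdx, hxD] with s hs hsD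
    exact ((h.differentiableAt hsD).hasFDerivAt.comp_hasDerivAt s hs).deriv
  have hddx : HasDerivAt (deriv x) (deriv (deriv x) t) t :=
    ((hx.derivWithin (m := ∞) (by simp)).differentiableAt (by simp)).hasDerivAt
  have hsnd := (((h.differentiableAt_fderiv ht).hasFDerivAt.comp_hasDerivAt t
    hdx.self_of_nhds).clm_apply hddx).deriv
  rw [acceleration, acceleration, map_add, h.fderiv_connection ht, hfst.deriv_eq,
    hfst.self_of_nhds]
  simp only [Function.comp_apply] at hsnd ⊢
  rw [hsnd]
  abel

end IsIsometryOn

end ChangeOfCoordinates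

section DifferentialEquations

variable {F : Type*} [NormedAddCommGroup F] [NormedSpace ℝ F]

lemma exists_contDiffOn_integralCurve [CompleteSpace F] {f : F → F} {O : Set F} (hO : IsOpen O)
    (hf : ContDiffOn ℝ ∞ f O) {z : F} (hz : z ∈ O) :
    ∃ ε > (0 : ℝ), ∃ α : ℝ → F, α 0 = z ∧ ContDiffOn ℝ ∞ α (Set.Ioo (-ε) ε) ∧
      ∀ t ∈ Set.Ioo (-ε) ε, α t ∈ O ∧ HasDerivAt α (f (α t)) t := by
  obtain ⟨α, hα0, δ, hδ, hα⟩ := ((hf.contDiffAt (hO.mem_nhds hz)).of_le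
    (by simp)).exists_forall_mem_closedBall_exists_eq_forall_mem_Ioo_hasDerivAt₀ 0
  simp only [zero_sub, zero_add] at hα
  have hmem : ∀ᶠ t in nhds (0 : ℝ), α t ∈ O ∧ HasDerivAt α (f (α t)) t :=
    Filter.Eventually.and
      ((hα 0 ⟨by linarith, hδ⟩).continuousAt.preimage_mem_nhds (hO.mem_nhds (by rwa [hα0])))
      (Filter.eventually_of_mem (Ioo_mem_nhds (by linarith) hδ) hα)
  obtain ⟨r, hr, hrα⟩ := Metric.nhds_basis_closedBall.eventually_iff.1 hmem
  rw [Real.closedBall_eq_Icc, zero_sub, zero_add] at hrα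
  have hsmooth : ContDiffOn ℝ ∞ α (Set.Icc (-r) r) :=
    ODE.contDiffOn_enat_Icc_of_hasDerivWithinAt (n := ⊤) (f := fun _ ↦ f) (u := O)
      (hf.comp contDiffOn_snd fun _ h ↦ h.2) (fun t ht ↦ (hrα ht).2.hasDerivWithinAt)
      fun t ht ↦ (hrα ht).1
  exact ⟨r, hr, α, hα0, hsmooth.mono Set.Ioo_subset_Icc_self,
    fun t ht ↦ hrα (Set.Ioo_subset_Icc_self ht)⟩

variable {E : Type*} [NormedAddCommGroup E] [NormedSpace ℝ E] [FiniteDimensional ℝ E]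
  {b : E → E →L[ℝ] E →L[ℝ] ℝ} {D : Set E} {y : E}

namespace IsMetricOn

lemma exists_geodesic (hb : IsMetricOn b D) (hy : y ∈ D) {u : E} (hu : u ≠ 0) :
    ∃ ε > (0 : ℝ), ∃ x : ℝ → E, x 0 = y ∧ deriv x 0 = u ∧ ContDiffOn ℝ ∞ x (Set.Ioo (-ε) ε) ∧
      ∀ t ∈ Set.Ioo (-ε) ε, x t ∈ D ∧ deriv x t ≠ 0 ∧ acceleration b x t = 0 := by
  let f : E × E → E × E := fun z ↦ (z.2, -connection b z.1 z.2 z.2)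
  have hf : ContDiffOn ℝ ∞ f (D ×ˢ {0}ᶜ) :=
    contDiffOn_snd.prodMk (((hb.connection_contDiffOn.comp contDiffOn_fst fun z hz ↦
      hz.1).clm_apply contDiffOn_snd).clm_apply contDiffOn_snd).neg
  obtain ⟨ε, hε, α, hα0, hsmooth, hα⟩ := exists_contDiffOn_integralCurve (z := (y, u))
    (hb.isOpen.prod isOpen_compl_singleton) hf ⟨hy, hu⟩
  let x : ℝ → E := fun t ↦ (α t).1
  have hx (t) (ht : t ∈ Set.Ioo (-ε) ε) : deriv x t = (α t).2 :=
    ((ContinuousLinearMap.fst ℝ E E).hasFDerivAt.comp_hasDerivAt t (hα t ht).2).deriv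
  have hdx (t) (ht : t ∈ Set.Ioo (-ε) ε) :
      deriv (deriv x) t = -connection b (x t) (deriv x t) (deriv x t) := by
    have heq : deriv x =ᶠ[nhds t] fun s ↦ (α s).2 :=
      Filter.eventually_of_mem (isOpen_Ioo.mem_nhds ht) hx
    rw [heq.deriv_eq, hx t ht]
    exact ((ContinuousLinearMap.snd ℝ E E).hasFDerivAt.comp_hasDerivAt t (hα t ht).2).deriv
  have h0 : (0 : ℝ) ∈ Set.Ioo (-ε) ε := ⟨by linarith, hε⟩
  refine ⟨ε, hε, x, by simp [x, hα0], by simp [hx 0 h0, hα0],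
    contDiff_fst.comp_contDiffOn hsmooth, fun t ht ↦ ⟨(hα t ht).1.1, ?_, ?_⟩⟩
  · rw [hx t ht]
    exact (hα t ht).1.2
  · rw [acceleration, hdx t ht, neg_add_cancel]

lemma eventually_eq_zero_of_parallel (hb : IsMetricOn b D) (hy : y ∈ D) {P : E → E}
    (hP : ContDiffOn ℝ ∞ P D) (hpar : ∀ w ∈ D, covDeriv b P w = 0) (h0 : P y = 0) :
    ∀ᶠ z in nhds y, P z = 0 := by
  have hbound : ∀ᶠ z in nhds y, ‖connection b z‖ < ‖connection b y‖ + 1 :=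
    (hb.connection_differentiableAt hy).continuousAt.norm.eventually_lt_const (by linarith)
  obtain ⟨r, hr, hrD⟩ := Metric.eventually_nhds_iff_ball.1 (hbound.and (hb.isOpen.mem_nhds hy))
  refine Metric.eventually_nhds_iff_ball.2 ⟨r, hr, fun z hz ↦ ?_⟩
  let c : ℝ → E := AffineMap.lineMap y z
  have hc (t) (ht : t ∈ Set.Icc (0 : ℝ) 1) : c t ∈ Metric.ball y r :=
    (convex_ball y r).lineMap_mem (Metric.mem_ball_self hr) hz ht
  have hderiv (t) (ht : t ∈ Set.Icc (0 : ℝ) 1) :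
      HasDerivAt (fun s ↦ P (c s)) (-connection b (c t) (z - y) (P (c t))) t := by
    have hD := (hrD _ (hc t ht)).2
    have hPc := (differentiableAt_of_contDiffOn hP hb.isOpen hD).hasFDerivAt.comp_hasDerivAt t
      AffineMap.hasDerivAt_lineMap
    have hpar := DFunLike.congr_fun (hpar _ hD) (z - y)
    rw [covDeriv_apply, zero_apply] at hpar
    rwa [eq_neg_of_add_eq_zero_left hpar] at hPc
  -- Gronwall's inequality for the linear equation that `P` satisfies along a segment.
  have hgronwall := norm_le_gronwallBound_of_norm_deriv_right_le (f := fun t ↦ P (c t)) (δ := 0)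
    (K := (‖connection b y‖ + 1) * ‖z - y‖) (ε := 0) (a := 0) (b := 1)
    (fun t ht ↦ (hderiv t ht).continuousAt.continuousWithinAt)
    (fun t ht ↦ (hderiv t (Set.Ico_subset_Icc_self ht)).hasDerivWithinAt) (by simp [c, h0])
    (fun t ht ↦ by
      rw [norm_neg, add_zero]
      refine ((connection b (c t)).le_opNorm₂ _ _).trans ?_
      have := (hrD _ (hc t (Set.Ico_subset_Icc_self ht))).1
      gcongr) 1 (by simp)
  simpa [c, gronwallBound_ε0_δ0] using hgronwall

end IsMetricOn

end DifferentialEquations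

section Charts

open Bundle

variable {E : Type*} [NormedAddCommGroup E] [NormedSpace ℝ E]
  {M : Type*} [TopologicalSpace M] [ChartedSpace E M]
  {e e' : OpenPartialHomeomorph M E} {y : E}

/-- The differential of the coordinate system `e` at `x`, with values in the coordinate space. -/
def coordDeriv (e : OpenPartialHomeomorph M E) (x : M) : TangentSpace 𝓘(ℝ, E) x →L[ℝ] E :=
  mfderiv 𝓘(ℝ, E) 𝓘(ℝ, E) e x

/-- The tangent vector with given components in the coordinate system `e`. -/
def coordVector (e : OpenPartialHomeomorph M E) (y : E) : E →L[ℝ] TangentSpace 𝓘(ℝ, E) (e.symm y) :=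
  mfderiv 𝓘(ℝ, E) 𝓘(ℝ, E) e.symm y

/-- The components of a field of endomorphisms in the coordinate system `e`. -/
def endInChart (A : (p : M) → TangentSpace 𝓘(ℝ, E) p →L[ℝ] TangentSpace 𝓘(ℝ, E) p)
    (e : OpenPartialHomeomorph M E) (y : E) : E →L[ℝ] E :=
  (coordDeriv e (e.symm y)).comp ((A (e.symm y)).comp (coordVector e y))

lemma endInChart_apply (A : (p : M) → TangentSpace 𝓘(ℝ, E) p →L[ℝ] TangentSpace 𝓘(ℝ, E) p)
    (e : OpenPartialHomeomorph M E) (y v : E) :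
    endInChart A e y v = coordDeriv e (e.symm y) (A (e.symm y) (coordVector e y v)) := rfl

lemma mdifferentiable_of_mem_maximalAtlas (he : e ∈ IsManifold.maximalAtlas 𝓘(ℝ, E) ∞ M) :
    e.MDifferentiable 𝓘(ℝ, E) 𝓘(ℝ, E) :=
  ⟨(contMDiffOn_of_mem_maximalAtlas he).mdifferentiableOn (by simp),
    (contMDiffOn_symm_of_mem_maximalAtlas he).mdifferentiableOn (by simp)⟩

lemma contDiffOn_transition (he : e ∈ IsManifold.maximalAtlas 𝓘(ℝ, E) ∞ M)
    (he' : e' ∈ IsManifold.maximalAtlas 𝓘(ℝ, E) ∞ M) :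
    ContDiffOn ℝ ∞ (e' ∘ e.symm) (e.target ∩ e.symm ⁻¹' e'.source) :=
  ((contMDiffOn_of_mem_maximalAtlas he').comp
    ((contMDiffOn_symm_of_mem_maximalAtlas he).mono Set.inter_subset_left)
    fun _ hy ↦ hy.2).contDiffOn

lemma coordDeriv_coordVector (he : e ∈ IsManifold.maximalAtlas 𝓘(ℝ, E) ∞ M)
    (hy : y ∈ e.target) (v : E) : coordDeriv e (e.symm y) (coordVector e y v) = v :=
  DFunLike.congr_fun ((mdifferentiable_of_mem_maximalAtlas he).comp_symm_deriv hy) v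

lemma coordVector_coordDeriv (he : e ∈ IsManifold.maximalAtlas 𝓘(ℝ, E) ∞ M)
    (hy : y ∈ e.target) (v : TangentSpace 𝓘(ℝ, E) (e.symm y)) :
    coordVector e y (coordDeriv e (e.symm y) v) = v :=
  (mdifferentiable_of_mem_maximalAtlas he).mfderiv_injective (e.map_target hy)
    (coordDeriv_coordVector he hy _)

lemma fderiv_comp_chart_symm {F : Type*} [NormedAddCommGroup F] [NormedSpace ℝ F] {f : M → F}
    (he : e ∈ IsManifold.maximalAtlas 𝓘(ℝ, E) ∞ M) (hy : y ∈ e.target)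
    (hf : MDifferentiableAt 𝓘(ℝ, E) 𝓘(ℝ, F) f (e.symm y)) (v : E) :
    fderiv ℝ (f ∘ e.symm) y v = mfderiv 𝓘(ℝ, E) 𝓘(ℝ, F) f (e.symm y) (coordVector e y v) := by
  rw [← mfderiv_eq_fderiv, mfderiv_comp (I' := 𝓘(ℝ, E)) y hf
    ((mdifferentiable_of_mem_maximalAtlas he).mdifferentiableAt_symm hy)]
  rfl

lemma coordVector_vectorInChart (he : e ∈ IsManifold.maximalAtlas 𝓘(ℝ, E) ∞ M)
    (hy : y ∈ e.target) (X : (p : M) → TangentSpace 𝓘(ℝ, E) p) :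
    coordVector e y (vectorInChart X e y) = X (e.symm y) :=
  coordVector_coordDeriv he hy _

lemma vectorInChart_eq_zero_iff (he : e ∈ IsManifold.maximalAtlas 𝓘(ℝ, E) ∞ M)
    (hy : y ∈ e.target) (X : (p : M) → TangentSpace 𝓘(ℝ, E) p) :
    vectorInChart X e y = 0 ↔ X (e.symm y) = 0 := by
  refine ⟨fun h ↦ ?_, fun h ↦ ?_⟩
  · rw [← coordVector_vectorInChart he hy X, h, map_zero]
  · exact (congrArg (coordDeriv e (e.symm y)) h).trans (coordDeriv e (e.symm y)).map_zero

lemma vectorInChart_transition (he : e ∈ IsManifold.maximalAtlas 𝓘(ℝ, E) ∞ M)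
    (he' : e' ∈ IsManifold.maximalAtlas 𝓘(ℝ, E) ∞ M)
    (hy : y ∈ e.target ∩ e.symm ⁻¹' e'.source) (X : (p : M) → TangentSpace 𝓘(ℝ, E) p) :
    vectorInChart X e' ((e' ∘ e.symm) y) = fderiv ℝ (e' ∘ e.symm) y (vectorInChart X e y) := by
  rw [fderiv_comp_chart_symm he hy.1
    ((mdifferentiable_of_mem_maximalAtlas he').mdifferentiableAt hy.2),
    coordVector_vectorInChart he hy.1]
  have h (x : M) (hx : x = e.symm y) :
      coordDeriv e' x (X x) = coordDeriv e' (e.symm y) (X (e.symm y)) := by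
    subst hx; rfl
  exact h _ (e'.left_inv hy.2)

lemma vectorInChart_smul (c : M → ℝ) (X : (p : M) → TangentSpace 𝓘(ℝ, E) p)
    (e : OpenPartialHomeomorph M E) (y : E) :
    vectorInChart (fun p ↦ c p • X p) e y = c (e.symm y) • vectorInChart X e y :=
  (coordDeriv e (e.symm y)).map_smul _ _

lemma vectorInChart_sub (X Y : (p : M) → TangentSpace 𝓘(ℝ, E) p)
    (e : OpenPartialHomeomorph M E) (y : E) :
    vectorInChart (fun p ↦ X p - Y p) e y = vectorInChart X e y - vectorInChart Y e y :=
  (coordDeriv e (e.symm y)).map_sub _ _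

lemma vectorInChart_end (A : (p : M) → TangentSpace 𝓘(ℝ, E) p →L[ℝ] TangentSpace 𝓘(ℝ, E) p)
    (he : e ∈ IsManifold.maximalAtlas 𝓘(ℝ, E) ∞ M) (hy : y ∈ e.target)
    (X : (p : M) → TangentSpace 𝓘(ℝ, E) p) :
    vectorInChart (fun p ↦ A p (X p)) e y = endInChart A e y (vectorInChart X e y) := by
  rw [endInChart_apply, coordVector_vectorInChart he hy]
  rfl

lemma vectorInChart_end_pow (A : (p : M) → TangentSpace 𝓘(ℝ, E) p →L[ℝ] TangentSpace 𝓘(ℝ, E) p)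
    (he : e ∈ IsManifold.maximalAtlas 𝓘(ℝ, E) ∞ M) (hy : y ∈ e.target)
    (X : (p : M) → TangentSpace 𝓘(ℝ, E) p) (k : ℕ) :
    vectorInChart (fun p ↦ (A p ^ k) (X p)) e y =
      (endInChart A e y ^ k) (vectorInChart X e y) := by
  induction k with
  | zero => rfl
  | succ k ih =>
    simp only [pow_succ', mul_apply_eq_comp, ← ih]
    exact vectorInChart_end A he hy fun p ↦ (A p ^ k) (X p)

lemma endInChart_smul (c : M → ℝ)
    (A : (p : M) → TangentSpace 𝓘(ℝ, E) p →L[ℝ] TangentSpace 𝓘(ℝ, E) p)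
    (e : OpenPartialHomeomorph M E) (y : E) :
    endInChart (fun p ↦ c p • A p) e y = c (e.symm y) • endInChart A e y := by
  ext v
  exact (coordDeriv e (e.symm y)).map_smul _ _

lemma det_endInChart (A : (p : M) → TangentSpace 𝓘(ℝ, E) p →L[ℝ] TangentSpace 𝓘(ℝ, E) p)
    (he : e ∈ IsManifold.maximalAtlas 𝓘(ℝ, E) ∞ M) (hy : y ∈ e.target) :
    (endInChart A e y).det = (A (e.symm y)).det := by
  let L : TangentSpace 𝓘(ℝ, E) (e.symm y) ≃ₗ[ℝ] E :=
    LinearEquiv.ofLinearMap (coordDeriv e (e.symm y) : TangentSpace 𝓘(ℝ, E) (e.symm y) →ₗ[ℝ] E)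
      (coordVector e y : E →ₗ[ℝ] TangentSpace 𝓘(ℝ, E) (e.symm y))
      (LinearMap.ext (coordDeriv_coordVector he hy))
      (LinearMap.ext (coordVector_coordDeriv he hy))
  exact LinearMap.det_conj
    (A (e.symm y) : TangentSpace 𝓘(ℝ, E) (e.symm y) →ₗ[ℝ] TangentSpace 𝓘(ℝ, E) (e.symm y)) L

variable [IsManifold 𝓘(ℝ, E) ∞ M]

lemma contMDiffOn_tangentMap {N : Type*} [TopologicalSpace N] [ChartedSpace E N]
    [IsManifold 𝓘(ℝ, E) ∞ N] {s : Set M} (hs : IsOpen s) {f : M → N}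
    (hf : ContMDiffOn 𝓘(ℝ, E) 𝓘(ℝ, E) ∞ f s) :
    ContMDiffOn 𝓘(ℝ, E).tangent 𝓘(ℝ, E).tangent ∞ (tangentMap 𝓘(ℝ, E) 𝓘(ℝ, E) f)
      (TotalSpace.proj (F := E) (E := (TangentSpace 𝓘(ℝ, E) : M → Type _)) ⁻¹' s) := by
  refine (hf.contMDiffOn_tangentMapWithin (by simp) hs.uniqueMDiffOn).congr fun p hp ↦ ?_
  simp only [tangentMap, tangentMapWithin]
  rw [mfderivWithin_of_isOpen hs hp]

lemma contMDiffOn_coordVector_const (he : e ∈ IsManifold.maximalAtlas 𝓘(ℝ, E) ∞ M) (v : E) :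
    ContMDiffOn 𝓘(ℝ, E) 𝓘(ℝ, E).tangent ∞ (fun y ↦ (TotalSpace.mk' E (e.symm y)
      (coordVector e y v) : TangentBundle 𝓘(ℝ, E) M)) e.target := by
  have h : ContMDiffOn 𝓘(ℝ, E) 𝓘(ℝ, E).tangent ∞
      (fun y ↦ (⟨y, v⟩ : TangentBundle 𝓘(ℝ, E) E)) e.target :=
    contMDiffOn_vectorSpace_iff_contDiffOn.2 contDiffOn_const
  exact (contMDiffOn_tangentMap e.open_target (contMDiffOn_symm_of_mem_maximalAtlas he)).comp h
    fun _ hy ↦ hy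

lemma contDiffOn_vectorInChart (he : e ∈ IsManifold.maximalAtlas 𝓘(ℝ, E) ∞ M)
    {X : (p : M) → TangentSpace 𝓘(ℝ, E) p}
    (hX : ContMDiff 𝓘(ℝ, E) 𝓘(ℝ, E).tangent ∞ (fun p ↦ (⟨p, X p⟩ : TangentBundle 𝓘(ℝ, E) M))) :
    ContDiffOn ℝ ∞ (vectorInChart X e) e.target :=
  ((contMDiff_snd_tangentBundle_modelSpace E 𝓘(ℝ, E)).comp_contMDiffOn
    ((contMDiffOn_tangentMap e.open_source (contMDiffOn_of_mem_maximalAtlas he)).comp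
      (hX.comp_contMDiffOn (contMDiffOn_symm_of_mem_maximalAtlas he))
      fun _ hy ↦ e.map_target hy)).contDiffOn

lemma contMDiff_of_vectorInChart {X : (p : M) → TangentSpace 𝓘(ℝ, E) p}
    (hX : ∀ e ∈ IsManifold.maximalAtlas 𝓘(ℝ, E) ∞ M,
      ContDiffOn ℝ ∞ (vectorInChart X e) e.target) :
    ContMDiff 𝓘(ℝ, E) 𝓘(ℝ, E).tangent ∞ (fun p ↦ (⟨p, X p⟩ : TangentBundle 𝓘(ℝ, E) M)) := by
  intro p
  set e := chartAt E p
  have he : e ∈ IsManifold.maximalAtlas 𝓘(ℝ, E) ∞ M := IsManifold.chart_mem_maximalAtlas p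
  have hchart : ContMDiffOn 𝓘(ℝ, E) 𝓘(ℝ, E).tangent ∞
      (fun y ↦ (⟨y, vectorInChart (E := E) X e y⟩ : TangentBundle 𝓘(ℝ, E) E)) e.target :=
    contMDiffOn_vectorSpace_iff_contDiffOn.2 (hX e he)
  have hpull := ((contMDiffOn_tangentMap e.open_target
    (contMDiffOn_symm_of_mem_maximalAtlas he)).comp hchart fun y hy ↦ hy).comp
    (contMDiffOn_of_mem_maximalAtlas he) fun q hq ↦ e.map_source hq
  refine (hpull.congr fun q hq ↦ ?_).contMDiffAt (e.open_source.mem_nhds (mem_chart_source E p))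
  have hbase : ∀ x, x = q → (⟨q, X q⟩ : TangentBundle 𝓘(ℝ, E) M) = ⟨x, X x⟩ := by
    rintro x rfl; rfl
  rw [hbase _ (e.left_inv hq)]
  exact congrArg (TotalSpace.mk' E (E := (TangentSpace 𝓘(ℝ, E) : M → Type _)) (e.symm (e q)))
    (coordVector_vectorInChart he (e.map_source hq) X).symm

lemma contMDiff_iff_contDiffOn_comp_symm {F : Type*} [NormedAddCommGroup F] [NormedSpace ℝ F]
    {f : M → F} : ContMDiff 𝓘(ℝ, E) 𝓘(ℝ, F) ∞ f ↔
      ∀ e ∈ IsManifold.maximalAtlas 𝓘(ℝ, E) ∞ M, ContDiffOn ℝ ∞ (f ∘ e.symm) e.target := by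
  refine ⟨fun h e he ↦
    (h.comp_contMDiffOn (contMDiffOn_symm_of_mem_maximalAtlas he)).contDiffOn, fun h p ↦ ?_⟩
  have he : chartAt E p ∈ IsManifold.maximalAtlas 𝓘(ℝ, E) ∞ M :=
    IsManifold.chart_mem_maximalAtlas p
  have hcomp := (h _ he).contMDiffOn.comp (contMDiffOn_of_mem_maximalAtlas he)
    fun q hq ↦ (chartAt E p).map_source hq
  refine (hcomp.congr fun q hq ↦ ?_).contMDiffAt
    ((chartAt E p).open_source.mem_nhds (mem_chart_source E p))
  simp [(chartAt E p).left_inv hq]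

end Charts

lemma IsMetricOn.mono {E : Type*} [NormedAddCommGroup E] [NormedSpace ℝ E]
    {b : E → E →L[ℝ] E →L[ℝ] ℝ} {D D' : Set E} (hb : IsMetricOn b D) (hD' : IsOpen D')
    (h : D' ⊆ D) : IsMetricOn b D' :=
  ⟨hD', hb.contDiffOn.mono h, fun y hy ↦ hb.symm y (h hy), fun y hy ↦ hb.nondegenerate y (h hy)⟩

namespace PseudoRiemannianMetric

open Bundle

variable {E : Type*} [NormedAddCommGroup E] [NormedSpace ℝ E]
  {M : Type*} [TopologicalSpace M] [ChartedSpace E M] [IsManifold 𝓘(ℝ, E) ∞ M]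
  (g : PseudoRiemannianMetric E M) {e e' : OpenPartialHomeomorph M E} {y : E}

lemma inChart_apply (e : OpenPartialHomeomorph M E) (y v w : E) :
    g.inChart e y v w = g.form (e.symm y) (coordVector e y v) (coordVector e y w) := rfl

lemma inChart_coordDeriv (he : e ∈ IsManifold.maximalAtlas 𝓘(ℝ, E) ∞ M) (hy : y ∈ e.target)
    {x : M} (hx : e.symm y = x) (v w : TangentSpace 𝓘(ℝ, E) x) :
    g.inChart e y (coordDeriv e x v) (coordDeriv e x w) = g.form x v w := by
  subst hx
  rw [inChart_apply, coordVector_coordDeriv he hy, coordVector_coordDeriv he hy]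

lemma inChart_vectorInChart (he : e ∈ IsManifold.maximalAtlas 𝓘(ℝ, E) ∞ M) (hy : y ∈ e.target)
    (X Y : (p : M) → TangentSpace 𝓘(ℝ, E) p) :
    g.inChart e y (vectorInChart X e y) (vectorInChart Y e y) =
      g.form (e.symm y) (X (e.symm y)) (Y (e.symm y)) :=
  g.inChart_coordDeriv he hy rfl _ _

lemma inChart_transition (he : e ∈ IsManifold.maximalAtlas 𝓘(ℝ, E) ∞ M)
    (he' : e' ∈ IsManifold.maximalAtlas 𝓘(ℝ, E) ∞ M)
    (hy : y ∈ e.target ∩ e.symm ⁻¹' e'.source) (v w : E) :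
    g.inChart e y v w = g.inChart e' ((e' ∘ e.symm) y)
      (fderiv ℝ (e' ∘ e.symm) y v) (fderiv ℝ (e' ∘ e.symm) y w) := by
  have hd := (mdifferentiable_of_mem_maximalAtlas he').mdifferentiableAt hy.2
  rw [fderiv_comp_chart_symm he hy.1 hd, fderiv_comp_chart_symm he hy.1 hd, inChart_apply]
  exact (g.inChart_coordDeriv he' (e'.map_source hy.2) (e'.left_inv hy.2) _ _).symm

lemma covDerivInChart_eq (X : (p : M) → TangentSpace 𝓘(ℝ, E) p) (e : OpenPartialHomeomorph M E)
    (y u : E) : covDerivInChart g X e y u = covDeriv (g.inChart e) (vectorInChart X e) y u := rfl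

variable [FiniteDimensional ℝ E]

lemma isInvertible_form (p : M) : (g.form p).IsInvertible :=
  isInvertible_of_nondegenerate (E := E) (g.form p) (g.nondegenerate p)

lemma contDiffOn_inChart (he : e ∈ IsManifold.maximalAtlas 𝓘(ℝ, E) ∞ M) :
    ContDiffOn ℝ ∞ (g.inChart e) e.target := by
  refine contDiffOn_clm_apply.2 fun v ↦ contDiffOn_clm_apply.2 fun w ↦ ?_
  have h : ContMDiffOn 𝓘(ℝ, E) (𝓘(ℝ, E).prod 𝓘(ℝ, ℝ)) ∞ (fun y ↦ TotalSpace.mk' ℝ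
      (E := Bundle.Trivial M ℝ) (e.symm y) (g.form (e.symm y)
        (coordVector e y v) (coordVector e y w))) e.target := by
    apply ContMDiffOn.clm_bundle_apply₂ (F₁ := E) (F₂ := E)
      (E₁ := (TangentSpace 𝓘(ℝ, E) : M → Type _)) (E₂ := (TangentSpace 𝓘(ℝ, E) : M → Type _))
    · exact g.contMDiff.comp_contMDiffOn (contMDiffOn_symm_of_mem_maximalAtlas he)
    · exact contMDiffOn_coordVector_const he v
    · exact contMDiffOn_coordVector_const he w
  exact fun y hy ↦ (contMDiffWithinAt_totalSpace.1 (h y hy)).2.contDiffWithinAt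

lemma isMetricOn_inChart (he : e ∈ IsManifold.maximalAtlas 𝓘(ℝ, E) ∞ M) :
    IsMetricOn (g.inChart e) e.target where
  isOpen := e.open_target
  contDiffOn := g.contDiffOn_inChart he
  symm y _ v w := g.symm (e.symm y) (coordVector e y v) (coordVector e y w)
  nondegenerate y hy v hv := by
    have hzero : coordVector e y v = 0 := g.nondegenerate _ _ fun w ↦ by
      simpa only [inChart_apply, coordVector_coordDeriv he hy] using
        hv (coordDeriv e (e.symm y) w)
    rw [← coordDeriv_coordVector he hy v, hzero, map_zero]

lemma isIsometryOn_transition (he : e ∈ IsManifold.maximalAtlas 𝓘(ℝ, E) ∞ M)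
    (he' : e' ∈ IsManifold.maximalAtlas 𝓘(ℝ, E) ∞ M) :
    IsIsometryOn (e' ∘ e.symm) (g.inChart e) (g.inChart e')
      (e.target ∩ e.symm ⁻¹' e'.source) e'.target where
  source := (g.isMetricOn_inChart he).mono (e.symm.isOpen_inter_preimage e'.open_source)
    Set.inter_subset_left
  target := g.isMetricOn_inChart he'
  contDiffOn := contDiffOn_transition he he'
  mapsTo _ hy := e'.map_source hy.2
  form_apply _ hy := g.inChart_transition he he' hy

end PseudoRiemannianMetric

section ConcircularFields

variable {E : Type*} [NormedAddCommGroup E] [NormedSpace ℝ E]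
  {M : Type*} [TopologicalSpace M] [ChartedSpace E M] [IsManifold 𝓘(ℝ, E) ∞ M]
  {g : PseudoRiemannianMetric E M} {X : (p : M) → TangentSpace 𝓘(ℝ, E) p} {ρ : M → ℝ}
  {e : OpenPartialHomeomorph M E} {y : E}

lemma IsConcircular.scalar_eq_zero (hX : IsConcircular g X ρ)
    (hno : ¬HasBasicConcircularField g) : ρ = 0 := by
  by_contra hρ
  exact hno ⟨X, ρ, hX, Function.ne_iff.1 hρ⟩

lemma IsConcircular.contDiffOn (hX : IsConcircular g X ρ) :
    ∀ e ∈ IsManifold.maximalAtlas 𝓘(ℝ, E) ∞ M, ContDiffOn ℝ ∞ (vectorInChart X e) e.target :=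
  fun _ he ↦ contDiffOn_vectorInChart he hX.smooth_field

variable [FiniteDimensional ℝ E]

lemma IsConcircular.covDeriv_eq (hX : IsConcircular g X ρ)
    (he : e ∈ IsManifold.maximalAtlas 𝓘(ℝ, E) ∞ M) (hy : y ∈ e.target) :
    covDeriv (g.inChart e) (vectorInChart X e) y =
      ρ (e.symm y) • ContinuousLinearMap.id ℝ E := by
  have hg := g.isMetricOn_inChart he
  ext u
  refine hg.ext hy fun w ↦ ?_
  rw [← g.covDerivInChart_eq, hX.eq e he y hy, hg.symm y hy]
  simp

lemma IsConcircular.covDeriv_eq_zero (hX : IsConcircular g X 0)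
    (he : e ∈ IsManifold.maximalAtlas 𝓘(ℝ, E) ∞ M) (hy : y ∈ e.target) :
    covDeriv (g.inChart e) (vectorInChart X e) y = 0 :=
  (hX.covDeriv_eq he hy).trans (zero_smul ℝ _)

lemma isConcircular_of_covDeriv_eq [Nontrivial E]
    (hX : ∀ e ∈ IsManifold.maximalAtlas 𝓘(ℝ, E) ∞ M,
      ContDiffOn ℝ ∞ (vectorInChart X e) e.target)
    (hρ : ∀ e ∈ IsManifold.maximalAtlas 𝓘(ℝ, E) ∞ M, ∀ y ∈ e.target,
      covDeriv (g.inChart e) (vectorInChart X e) y =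
        ρ (e.symm y) • ContinuousLinearMap.id ℝ E) :
    IsConcircular g X ρ where
  smooth_field := contMDiff_of_vectorInChart hX
  smooth_scalar := by
    obtain ⟨u, hu⟩ := exists_ne (0 : E)
    obtain ⟨φ, hφ⟩ := SeparatingDual.exists_eq_one (R := ℝ) hu
    refine contMDiff_iff_contDiffOn_comp_symm.2 fun e he ↦ ?_
    have hcov := (g.isMetricOn_inChart he).covDeriv_contDiffOn (hX e he)
    refine (φ.contDiff.comp_contDiffOn (hcov.clm_apply (contDiffOn_const (c := u)))).congr
      fun y hy ↦ ?_
    simp [hρ e he y hy, hφ]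
  eq e he y hy v u := by
    rw [g.covDerivInChart_eq, hρ e he y hy, (g.isMetricOn_inChart he).symm y hy]
    simp

lemma exists_isConcircular_of_covDeriv_eq [Nontrivial E]
    (hX : ∀ e ∈ IsManifold.maximalAtlas 𝓘(ℝ, E) ∞ M,
      ContDiffOn ℝ ∞ (vectorInChart X e) e.target)
    (hμ : ∀ e ∈ IsManifold.maximalAtlas 𝓘(ℝ, E) ∞ M, ∀ y ∈ e.target,
      ∃ μ : ℝ, covDeriv (g.inChart e) (vectorInChart X e) y = μ • ContinuousLinearMap.id ℝ E) :
    ∃ ρ, IsConcircular g X ρ := by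
  choose ρ hρ using fun p : M ↦ hμ (chartAt E p) (IsManifold.chart_mem_maximalAtlas p)
    (chartAt E p p) (mem_chart_target E p)
  refine ⟨ρ, isConcircular_of_covDeriv_eq hX fun e he y hy ↦ ?_⟩
  set c := chartAt E (e.symm y)
  have hc : c ∈ IsManifold.maximalAtlas 𝓘(ℝ, E) ∞ M := IsManifold.chart_mem_maximalAtlas _
  have hyc : y ∈ e.target ∩ e.symm ⁻¹' c.source := ⟨hy, mem_chart_source E (e.symm y)⟩
  have hτ := g.isIsometryOn_transition he hc
  ext u
  refine hτ.fderiv_injective hyc ?_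
  rw [hτ.fderiv_covDeriv hyc (differentiableAt_of_contDiffOn (hX e he) e.open_target hy)
    (differentiableAt_of_contDiffOn (hX c hc) c.open_target (hτ.mapsTo hyc))
    (fun z hz ↦ vectorInChart_transition he hc hz X)]
  rw [Function.comp_apply, hρ]
  simp

lemma IsConcircular.isLocallyConstant_eq_zero (hX : IsConcircular g X 0) :
    IsLocallyConstant fun p ↦ X p = 0 := by
  refine IsLocallyConstant.iff_eventually_eq _ |>.2 fun p ↦ ?_
  set e := chartAt E p
  have he : e ∈ IsManifold.maximalAtlas 𝓘(ℝ, E) ∞ M := IsManifold.chart_mem_maximalAtlas p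
  have hp : p ∈ e.source := mem_chart_source E p
  have hiff (q : M) (hq : q ∈ e.source) : (vectorInChart X e (e q) = 0) = (X q = 0) := by
    have h := vectorInChart_eq_zero_iff he (e.map_source hq) X
    rw [e.left_inv hq] at h
    exact propext h
  have hchart : ∀ᶠ z in nhds (e p), (vectorInChart X e z = 0) = (vectorInChart X e (e p) = 0) := by
    by_cases h0 : vectorInChart X e (e p) = 0
    · filter_upwards [(g.isMetricOn_inChart he).eventually_eq_zero_of_parallel (e.map_source hp)
        (hX.contDiffOn e he) (fun w hw ↦ hX.covDeriv_eq_zero he hw) h0] with z hz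
      rw [hz, h0]
    · filter_upwards [(differentiableAt_of_contDiffOn (hX.contDiffOn e he)
        e.open_target (e.map_source hp)).continuousAt.eventually_ne h0] with z hz
      exact propext (iff_of_false hz h0)
  filter_upwards [(e.continuousAt hp).eventually hchart, e.open_source.mem_nhds hp] with q hq hqe
  rw [← hiff q hqe, hq, hiff p hp]

end ConcircularFields

section SinyukovPairs

lemma IsSinyukovOn.congr {E : Type*} [NormedAddCommGroup E] [NormedSpace ℝ E]
    {b : E → E →L[ℝ] E →L[ℝ] ℝ} {A A' : E → E →L[ℝ] E} {l l' : E → E} {D : Set E}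
    (hS : IsSinyukovOn b A l D) (hD : IsOpen D) (hA : Set.EqOn A' A D) (hl : Set.EqOn l' l D) :
    IsSinyukovOn b A' l' D where
  contDiffOn_end := hS.contDiffOn_end.congr hA
  contDiffOn_field := hS.contDiffOn_field.congr hl
  self_adjoint y hy v w := by rw [hA hy, hS.self_adjoint y hy]
  covDerivEnd_apply y hy u v := by
    rw [_root_.covDerivEnd_apply, (hA.eventuallyEq_of_mem (hD.mem_nhds hy)).fderiv_eq, hA hy, hl hy]
    exact hS.covDerivEnd_apply y hy u v

lemma IsSinyukovOn.smul {E : Type*} [NormedAddCommGroup E] [NormedSpace ℝ E]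
    {b : E → E →L[ℝ] E →L[ℝ] ℝ} {A : E → E →L[ℝ] E} {l : E → E} {D : Set E}
    (hS : IsSinyukovOn b A l D) (hD : IsOpen D) {c : E → ℝ}
    (hc : ∀ y ∈ D, ∀ᶠ z in nhds y, c z = c y) :
    IsSinyukovOn b (fun y ↦ c y • A y) (fun y ↦ c y • l y) D := by
  have hc_smooth : ContDiffOn ℝ ∞ c D := fun y hy ↦
    (contDiffAt_const.congr_of_eventuallyEq (hc y hy)).contDiffWithinAt
  refine ⟨hc_smooth.smul hS.contDiffOn_end, hc_smooth.smul hS.contDiffOn_field,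
    fun y hy v w ↦ ?_, fun y hy u v ↦ ?_⟩
  · simp [hS.self_adjoint y hy]
  · have hcy : c =ᶠ[nhds y] fun _ ↦ c y := hc y hy
    have hdc : fderiv ℝ c y = 0 := hcy.fderiv_eq.trans (fderiv_const_apply _)
    rw [covDerivEnd_smul (differentiableAt_of_contDiffOn hc_smooth hD hy)
      (differentiableAt_of_contDiffOn hS.contDiffOn_end hD hy)]
    simp only [add_apply, smul_apply, hS.covDerivEnd_apply y hy, hdc, zero_apply, map_smul]
    module

variable {E : Type*} [NormedAddCommGroup E] [NormedSpace ℝ E]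
  {M : Type*} [TopologicalSpace M] [ChartedSpace E M] [IsManifold 𝓘(ℝ, E) ∞ M]
  {h : PseudoRiemannianMetric E M}
  {A : (p : M) → TangentSpace 𝓘(ℝ, E) p →L[ℝ] TangentSpace 𝓘(ℝ, E) p}
  {l P Q : (p : M) → TangentSpace 𝓘(ℝ, E) p}

/-- The field of endomorphisms `A` and the vector field `l` satisfy Sinyukov's equation for the
metric `h` in every coordinate system. -/
def IsSinyukovPair (h : PseudoRiemannianMetric E M)
    (A : (p : M) → TangentSpace 𝓘(ℝ, E) p →L[ℝ] TangentSpace 𝓘(ℝ, E) p)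
    (l : (p : M) → TangentSpace 𝓘(ℝ, E) p) : Prop :=
  ∀ e ∈ IsManifold.maximalAtlas 𝓘(ℝ, E) ∞ M,
    IsSinyukovOn (h.inChart e) (endInChart A e) (vectorInChart l e) e.target

namespace IsSinyukovPair

lemma smul (hS : IsSinyukovPair h A l) {c : M → ℝ} (hc : IsLocallyConstant c) :
    IsSinyukovPair h (fun p ↦ c p • A p) (fun p ↦ c p • l p) := fun e he ↦ by
  have hc_chart : ∀ y ∈ e.target, ∀ᶠ z in nhds y, c (e.symm z) = c (e.symm y) := fun y hy ↦
    (e.symm.continuousAt hy).eventually (hc.eventually_eq (e.symm y))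
  have hA : endInChart (fun p ↦ c p • A p) e = fun y ↦ c (e.symm y) • endInChart A e y :=
    funext fun y ↦ endInChart_smul c A e y
  have hl : vectorInChart (fun p ↦ c p • l p) e = fun y ↦ c (e.symm y) • vectorInChart l e y :=
    funext fun y ↦ vectorInChart_smul c l e y
  rw [hA, hl]
  exact (hS e he).smul e.open_target hc_chart

variable [FiniteDimensional ℝ E] [Nontrivial E]

lemma exists_isConcircular (hS : IsSinyukovPair h A l) (hP : IsConcircular h P 0)
    (hl : ∀ p, P p = 0 → l p = 0) : ∃ μ, IsConcircular h l μ := by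
  refine exists_isConcircular_of_covDeriv_eq (fun e he ↦ (hS e he).contDiffOn_field)
    fun e he y hy ↦ ?_
  by_cases hPy : P (e.symm y) = 0
  · have hl0 : vectorInChart l e =ᶠ[nhds y] fun _ ↦ 0 := by
      filter_upwards [(e.symm.continuousAt hy).eventually
        (hP.isLocallyConstant_eq_zero.eventually_eq (e.symm y)), e.open_target.mem_nhds hy]
        with z hz hze
      exact (vectorInChart_eq_zero_iff he hze l).2 (hl _ (hz.mpr hPy))
    refine ⟨0, ?_⟩
    rw [covDeriv_congr hl0]
    ext u
    simp [covDeriv_apply]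
  · exact (hS e he).exists_covDeriv_eq_smul (h.isMetricOn_inChart he) hy (hP.contDiffOn e he)
      (fun w hw ↦ hP.covDeriv_eq_zero he hw)
      fun h0 ↦ hPy ((vectorInChart_eq_zero_iff he hy P).1 h0)

lemma isConcircular_moment_combination (hS : IsSinyukovPair h A l) (hQ : IsConcircular h Q 0)
    (hl : IsConcircular h l 0) {m : ℕ}
    (hlQ : ∀ j < m, ∀ p, h.form p (l p) ((A p ^ j) (Q p)) = 0)
    (hll : ∀ j < m, ∀ p, h.form p (l p) ((A p ^ j) (l p)) = 0) :
    IsConcircular h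
      (fun p ↦ (2 * h.form p (l p) ((A p ^ m) (Q p))) • A p (Q p)
        - h.form p ((A p ^ (m + 1)) (Q p)) (Q p) • l p)
      (fun p ↦ 2 * h.form p (l p) ((A p ^ m) (Q p)) * h.form p (l p) (Q p)) := by
  set X : (p : M) → TangentSpace 𝓘(ℝ, E) p :=
    fun p ↦ (2 * h.form p (l p) ((A p ^ m) (Q p))) • A p (Q p)
      - h.form p ((A p ^ (m + 1)) (Q p)) (Q p) • l p
  let Z (e : OpenPartialHomeomorph M E) (y : E) : E :=
    (2 * h.inChart e y (vectorInChart l e y) ((endInChart A e y ^ m) (vectorInChart Q e y))) •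
        endInChart A e y (vectorInChart Q e y)
      - h.inChart e y ((endInChart A e y ^ (m + 1)) (vectorInChart Q e y)) (vectorInChart Q e y) •
        vectorInChart l e y
  have hXZ : ∀ e ∈ IsManifold.maximalAtlas 𝓘(ℝ, E) ∞ M, ∀ y ∈ e.target,
      vectorInChart X e y = Z e y := fun e he y hy ↦ by
    simp only [X, Z, ← vectorInChart_end_pow A he hy, ← vectorInChart_end A he hy,
      h.inChart_vectorInChart he hy, vectorInChart_sub, vectorInChart_smul]
  refine isConcircular_of_covDeriv_eq (fun e he ↦ ?_) fun e he y hy ↦ ?_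
  · have hb := h.contDiffOn_inChart he
    have hA := (hS e he).contDiffOn_end
    have hl := (hS e he).contDiffOn_field
    have hQ := hQ.contDiffOn e he
    exact (((contDiffOn_const.mul ((hb.clm_apply hl).clm_apply
      (contDiffOn_pow_apply hA hQ m))).smul (hA.clm_apply hQ)).sub
      (((hb.clm_apply (contDiffOn_pow_apply hA hQ (m + 1))).clm_apply hQ).smul hl)).congr (hXZ e he)
  · have hmoment (R : (p : M) → TangentSpace 𝓘(ℝ, E) p) (k : ℕ) :
        h.inChart e y (vectorInChart l e y) ((endInChart A e y ^ k) (vectorInChart R e y)) =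
          h.form (e.symm y) (l (e.symm y)) ((A (e.symm y) ^ k) (R (e.symm y))) := by
      rw [← vectorInChart_end_pow A he hy, h.inChart_vectorInChart he hy]
    rw [covDeriv_congr (Filter.eventually_of_mem (e.open_target.mem_nhds hy) (hXZ e he)),
      (hS e he).covDeriv_moment_combination (h.isMetricOn_inChart he) hy (hQ.contDiffOn e he)
        (hQ.covDeriv_eq_zero he hy) (hl.covDeriv_eq_zero he hy)
        (fun j hj ↦ (hmoment Q j).trans (hlQ j hj _)) (fun j hj ↦ (hmoment l j).trans (hll j hj _)),
      hmoment, h.inChart_vectorInChart he hy]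

lemma moment_eq_zero (hS : IsSinyukovPair h A l) (hno : ¬HasBasicConcircularField h)
    (hl : IsConcircular h l 0) (m : ℕ) (hQ : IsConcircular h Q 0) (p : M) :
    h.form p (l p) ((A p ^ m) (Q p)) = 0 := by
  induction m using Nat.strong_induction_on generalizing Q p with
  | _ m ih =>
  have hX := hS.isConcircular_moment_combination hQ hl (fun j hj ↦ ih j hj hQ)
    fun j hj ↦ ih j hj hl
  have hρ := hX.scalar_eq_zero hno
  rcases m with _ | m
  · simpa using congrFun hρ p
  · rw [hρ] at hX
    have hXm := ih m m.lt_succ_self hX p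
    have hlm := ih m m.lt_succ_self hl p
    have hpow : (A p ^ m) (A p (Q p)) = (A p ^ (m + 1)) (Q p) := by
      rw [pow_succ, mul_apply_eq_comp]
    rw [map_sub, map_smul, map_smul, map_sub, map_smul, map_smul, hlm, hpow] at hXm
    simpa using hXm

lemma exists_apply_eq_and_orthogonal (hS : IsSinyukovPair h A l)
    (hno : ¬HasBasicConcircularField h) (hP : IsConcircular h P 0) {p : M}
    (hA : Function.Injective (A p)) : ∃ w, A p w = P p ∧ h.form p (l p) w = 0 := by
  classical
  by_cases hPp : P p = 0
  · exact ⟨0, by rw [map_zero, hPp], map_zero _⟩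
  let c (q : M) : ℝ := if P q = 0 then 0 else 1
  have hcp : c p = 1 := if_neg hPp
  have hc : IsLocallyConstant c :=
    hP.isLocallyConstant_eq_zero.comp fun s : Prop ↦ if s then (0 : ℝ) else 1
  obtain ⟨μ, hμ⟩ := (hS.smul hc).exists_isConcircular hP fun q hq ↦ by simp [c, hq]
  have hl : IsConcircular h (fun q ↦ c q • l q) 0 := hμ.scalar_eq_zero hno ▸ hμ
  have : FiniteDimensional ℝ (TangentSpace 𝓘(ℝ, E) p) := inferInstanceAs (FiniteDimensional ℝ E)
  refine exists_preimage_mem_ker (A := (A p).toLinearMap) (φ := (h.form p (l p)).toLinearMap) hA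
    fun m ↦ ?_
  have hm := (hS.smul hc).moment_eq_zero hno hl m hP p
  simp only [hcp, one_smul] at hm
  rw [← ContinuousLinearMap.toLinearMap_pow]
  exact hm

end IsSinyukovPair

end SinyukovPairs

section ProjectiveEquivalence

variable {E : Type*} [NormedAddCommGroup E] [NormedSpace ℝ E]
  {M : Type*} [TopologicalSpace M] [ChartedSpace E M] [IsManifold 𝓘(ℝ, E) ∞ M]

/-- The Levi-Civita connections of `g` and `h` differ by a one-form as in Weyl's condition. -/
def ProjectivelyEquivalent (g h : PseudoRiemannianMetric E M) : Prop :=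
  ∀ e ∈ IsManifold.maximalAtlas 𝓘(ℝ, E) ∞ M, ∀ y ∈ e.target,
    ∃ ψ, IsProjectiveChange (g.inChart e) (h.inChart e) ψ y

/-- The differential of the function `Ψ`, typed as a form with values in `ℝ` and not in a tangent
space of `ℝ`. -/
def differential (Ψ : M → ℝ) (p : M) : TangentSpace 𝓘(ℝ, E) p →L[ℝ] ℝ :=
  mfderiv 𝓘(ℝ, E) 𝓘(ℝ, ℝ) Ψ p

namespace PseudoRiemannianMetric

/-- The gradient of the function `Ψ` with respect to the metric `g`. -/
def gradient (g : PseudoRiemannianMetric E M) (Ψ : M → ℝ) (p : M) : TangentSpace 𝓘(ℝ, E) p :=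
  (g.form p).inverse (differential Ψ p)

/-- The potential of the one-form of the projective change from `g` to `h`. -/
def projectivePotential (g h : PseudoRiemannianMetric E M) (p : M) : ℝ :=
  volumePotential (g.form p) (h.form p)

/-- The solution of Sinyukov's equation for `h` given by a metric `g` projectively equivalent
to `h`. -/
def sinyukovEnd (g h : PseudoRiemannianMetric E M) (p : M) :
    TangentSpace 𝓘(ℝ, E) p →L[ℝ] TangentSpace 𝓘(ℝ, E) p :=
  Real.exp (-2 * g.projectivePotential h p) • formRatio (g.form p) (h.form p)

/-- The vector field on the right-hand side of Sinyukov's equation for `sinyukovEnd g h`. -/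
def sinyukovField (g h : PseudoRiemannianMetric E M) (p : M) : TangentSpace 𝓘(ℝ, E) p :=
  Real.exp (-2 * g.projectivePotential h p) • g.gradient (g.projectivePotential h) p

variable [FiniteDimensional ℝ E] (g h : PseudoRiemannianMetric E M)
  {e : OpenPartialHomeomorph M E} {y : E}

lemma form_gradient (Ψ : M → ℝ) (p : M) :
    g.form p (g.gradient Ψ p) = differential Ψ p :=
  (g.isInvertible_form p).self_apply_inverse _

lemma vectorInChart_gradient (he : e ∈ IsManifold.maximalAtlas 𝓘(ℝ, E) ∞ M) (hy : y ∈ e.target)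
    {Ψ : M → ℝ} (hΨ : MDifferentiableAt 𝓘(ℝ, E) 𝓘(ℝ, ℝ) Ψ (e.symm y)) :
    vectorInChart (g.gradient Ψ) e y = (g.inChart e y).inverse (fderiv ℝ (Ψ ∘ e.symm) y) := by
  have hg := g.isMetricOn_inChart he
  refine hg.ext hy fun w ↦ ?_
  rw [(hg.isInvertible hy).self_apply_inverse, fderiv_comp_chart_symm he hy hΨ, inChart_apply,
    coordVector_vectorInChart he hy, form_gradient]
  rfl

lemma endInChart_formRatio (he : e ∈ IsManifold.maximalAtlas 𝓘(ℝ, E) ∞ M) (hy : y ∈ e.target) :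
    endInChart (fun p ↦ formRatio (g.form p) (h.form p)) e y =
      formRatio (g.inChart e y) (h.inChart e y) := by
  have hg := g.isMetricOn_inChart he
  ext v
  refine hg.ext hy fun w ↦ ?_
  rw [formRatio_apply (hg.isInvertible hy), inChart_apply, endInChart_apply,
    coordVector_coordDeriv he hy, formRatio_apply (g.isInvertible_form _), inChart_apply]

lemma projectivePotential_comp_symm (he : e ∈ IsManifold.maximalAtlas 𝓘(ℝ, E) ∞ M)
    (hy : y ∈ e.target) :
    g.projectivePotential h (e.symm y) = volumePotential (g.inChart e y) (h.inChart e y) := by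
  rw [projectivePotential, volumePotential, volumePotential, ← g.endInChart_formRatio h he hy,
    det_endInChart _ he hy]
  rfl

lemma contMDiff_projectivePotential :
    ContMDiff 𝓘(ℝ, E) 𝓘(ℝ, ℝ) ∞ (g.projectivePotential h) :=
  contMDiff_iff_contDiffOn_comp_symm.2 fun _ he ↦
    ((g.isMetricOn_inChart he).contDiffOn_volumePotential (h.isMetricOn_inChart he)).congr
      fun _ hy ↦ g.projectivePotential_comp_symm h he hy

lemma mdifferentiableAt_projectivePotential (p : M) :
    MDifferentiableAt 𝓘(ℝ, E) 𝓘(ℝ, ℝ) (g.projectivePotential h) p :=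
  (g.contMDiff_projectivePotential h).mdifferentiableAt (by simp)

lemma sinyukovEnd_injective (p : M) : Function.Injective (g.sinyukovEnd h p) := by
  have hratio : Function.Injective (formRatio (g.form p) (h.form p)) :=
    ((g.isInvertible_form p).inverse.comp (h.isInvertible_form p)).injective
  exact (smul_right_injective _ (Real.exp_pos _).ne').comp hratio

lemma form_sinyukovField (p : M) (w : TangentSpace 𝓘(ℝ, E) p) :
    h.form p (g.sinyukovField h p) w =
      differential (g.projectivePotential h) p (g.sinyukovEnd h p w) := by
  rw [h.symm, ← formRatio_apply (g.isInvertible_form p), g.symm, ← g.form_gradient]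
  simp only [sinyukovField, sinyukovEnd, map_smul, smul_apply]

end PseudoRiemannianMetric

namespace ProjectivelyEquivalent

variable {g h : PseudoRiemannianMetric E M} {e : OpenPartialHomeomorph M E} {y : E}

lemma symm (hgh : ProjectivelyEquivalent g h) : ProjectivelyEquivalent h g := fun e he y hy ↦
  (hgh e he y hy).imp' _ fun _ hψ ↦ hψ.symm

variable [FiniteDimensional ℝ E]

lemma isProjectiveChange (hgh : ProjectivelyEquivalent g h)
    (he : e ∈ IsManifold.maximalAtlas 𝓘(ℝ, E) ∞ M) (hy : y ∈ e.target) :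
    IsProjectiveChange (g.inChart e) (h.inChart e)
      (fderiv ℝ (g.projectivePotential h ∘ e.symm) y) y := by
  obtain ⟨ψ, hψ⟩ := hgh e he y hy
  have heq : g.projectivePotential h ∘ e.symm =ᶠ[nhds y]
      fun z ↦ volumePotential (g.inChart e z) (h.inChart e z) :=
    Filter.eventually_of_mem (e.open_target.mem_nhds hy) fun z hz ↦
      g.projectivePotential_comp_symm h he hz
  rwa [heq.fderiv_eq, ((g.isMetricOn_inChart he).hasFDerivAt_volumePotential
    (h.isMetricOn_inChart he) hy hψ).fderiv]

lemma isSinyukovPair (hgh : ProjectivelyEquivalent g h) :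
    IsSinyukovPair h (g.sinyukovEnd h) (g.sinyukovField h) := fun e he ↦ by
  refine (isSinyukovOn_formRatio (g.isMetricOn_inChart he) (h.isMetricOn_inChart he)
    (fun y hy ↦ hgh.isProjectiveChange he hy)
    (contMDiff_iff_contDiffOn_comp_symm.1 (g.contMDiff_projectivePotential h) e he)).congr
    e.open_target (fun y hy ↦ ?_) fun y hy ↦ ?_
  · exact (endInChart_smul _ _ e y).trans (congrArg _ (g.endInChart_formRatio h he hy))
  · exact (vectorInChart_smul _ _ e y).trans (congrArg _ (g.vectorInChart_gradient he hy
      (g.mdifferentiableAt_projectivePotential h _)))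

lemma isConcircular_exp_smul [Nontrivial E] (hgh : ProjectivelyEquivalent g h)
    {X : (p : M) → TangentSpace 𝓘(ℝ, E) p} {ρ : M → ℝ} (hX : IsConcircular g X ρ) :
    IsConcircular h (fun p ↦ Real.exp (-g.projectivePotential h p) • X p)
      fun p ↦ Real.exp (-g.projectivePotential h p) *
        (ρ p + differential (g.projectivePotential h) p (X p)) := by
  set Ψ := g.projectivePotential h
  have hΨ (e) (he : e ∈ IsManifold.maximalAtlas 𝓘(ℝ, E) ∞ M) :
      ContDiffOn ℝ ∞ (Ψ ∘ e.symm) e.target :=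
    contMDiff_iff_contDiffOn_comp_symm.1 (g.contMDiff_projectivePotential h) e he
  have hvec (e : OpenPartialHomeomorph M E) : vectorInChart (fun p ↦ Real.exp (-Ψ p) • X p) e =
      fun y ↦ Real.exp (-(Ψ ∘ e.symm) y) • vectorInChart X e y :=
    funext fun y ↦ vectorInChart_smul _ X e y
  refine isConcircular_of_covDeriv_eq (fun e he ↦ ?_) fun e he y hy ↦ ?_
  · rw [hvec]
    exact (hΨ e he).neg.exp.smul (hX.contDiffOn e he)
  · rw [hvec, (hgh.isProjectiveChange he hy).covDeriv_exp_smul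
      (differentiableAt_of_contDiffOn (hΨ e he) e.open_target hy).hasFDerivAt
      (differentiableAt_of_contDiffOn (hX.contDiffOn e he) e.open_target hy)
      (hX.covDeriv_eq he hy),
      fderiv_comp_chart_symm he hy (g.mdifferentiableAt_projectivePotential h _),
      coordVector_vectorInChart he hy]
    rfl

theorem hasBasicConcircularField (hgh : ProjectivelyEquivalent g h)
    (hg : HasBasicConcircularField g) : HasBasicConcircularField h := by
  obtain ⟨X, ρ, hX, p, hp⟩ := hg
  rcases subsingleton_or_nontrivial E with hE | hE
  · exact ⟨X, ρ, ⟨hX.smooth_field, hX.smooth_scalar, fun _ _ _ _ v _ ↦ by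
      simp [Subsingleton.elim v 0]⟩, p, hp⟩
  by_contra hno
  have hP := hgh.isConcircular_exp_smul hX
  have hρ := hP.scalar_eq_zero hno
  rw [hρ] at hP
  obtain ⟨w, hw, hlw⟩ := hgh.isSinyukovPair.exists_apply_eq_and_orthogonal hno hP
    (g.sinyukovEnd_injective h p)
  rw [g.form_sinyukovField h, hw, map_smul] at hlw
  have hdΨ := (smul_eq_zero.1 hlw).resolve_left (Real.exp_pos _).ne'
  have hρp := congrFun hρ p
  rw [hdΨ] at hρp
  simp [hp] at hρp

end ProjectivelyEquivalent

end ProjectiveEquivalence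

section Transport

variable {E : Type*} [NormedAddCommGroup E] [NormedSpace ℝ E]
  {M : Type*} [TopologicalSpace M] [ChartedSpace E M]
  {M' : Type*} [TopologicalSpace M'] [ChartedSpace E M']
  {e : OpenPartialHomeomorph M E} {y : E}

/-- The image of the coordinate system `e` under the diffeomorphism `f`. -/
def transportChart (f : M ≃ₘ⟮𝓘(ℝ, E), 𝓘(ℝ, E)⟯ M') (e : OpenPartialHomeomorph M E) :
    OpenPartialHomeomorph M' E :=
  f.symm.toHomeomorph.toOpenPartialHomeomorph.trans e

/-- The image of the vector field `X` under the diffeomorphism `f`. -/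
def pushField (f : M ≃ₘ⟮𝓘(ℝ, E), 𝓘(ℝ, E)⟯ M') (X : (p : M) → TangentSpace 𝓘(ℝ, E) p)
    (q : M') : TangentSpace 𝓘(ℝ, E) q :=
  (mfderiv 𝓘(ℝ, E) 𝓘(ℝ, E) f (f.symm q) (X (f.symm q)) : E)

variable (f : M ≃ₘ⟮𝓘(ℝ, E), 𝓘(ℝ, E)⟯ M')

lemma coe_transportChart (e : OpenPartialHomeomorph M E) :
    ⇑(transportChart f e) = e ∘ f.symm := rfl

lemma coe_transportChart_symm (e : OpenPartialHomeomorph M E) :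
    ⇑(transportChart f e).symm = f ∘ e.symm := rfl

lemma transportChart_target (e : OpenPartialHomeomorph M E) :
    (transportChart f e).target = e.target := by
  simp [transportChart]

lemma transportChart_source (e : OpenPartialHomeomorph M E) :
    (transportChart f e).source = f.symm ⁻¹' e.source := by
  simp [transportChart]

lemma transportChart_transportChart_symm (e : OpenPartialHomeomorph M' E) :
    transportChart f (transportChart f.symm e) = e := by
  refine OpenPartialHomeomorph.ext _ _ (fun x ↦ ?_) (fun x ↦ ?_) ?_
  · simp [coe_transportChart]
  · simp [coe_transportChart_symm]
  · ext x
    simp [transportChart_source]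

lemma coordVector_transportChart (he : e ∈ IsManifold.maximalAtlas 𝓘(ℝ, E) ∞ M)
    (hy : y ∈ e.target) (v : E) :
    coordVector (transportChart f e) y v =
      mfderiv 𝓘(ℝ, E) 𝓘(ℝ, E) f (e.symm y) (coordVector e y v) := by
  have h : mfderiv 𝓘(ℝ, E) 𝓘(ℝ, E) (f ∘ e.symm) y =
      (mfderiv 𝓘(ℝ, E) 𝓘(ℝ, E) f (e.symm y)).comp (mfderiv 𝓘(ℝ, E) 𝓘(ℝ, E) e.symm y) :=
    mfderiv_comp y (f.mdifferentiable (by simp) _)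
      ((mdifferentiable_of_mem_maximalAtlas he).mdifferentiableAt_symm hy)
  exact DFunLike.congr_fun h v

variable [IsManifold 𝓘(ℝ, E) ∞ M']

lemma transportChart_mem_maximalAtlas (he : e ∈ IsManifold.maximalAtlas 𝓘(ℝ, E) ∞ M) :
    transportChart f e ∈ IsManifold.maximalAtlas 𝓘(ℝ, E) ∞ M' := by
  rw [IsManifold.mem_maximalAtlas_iff_contMDiffOn]
  constructor
  · rw [transportChart_source, coe_transportChart]
    exact (contMDiffOn_of_mem_maximalAtlas he).comp f.symm.contMDiff.contMDiffOn fun _ hx ↦ hx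
  · rw [transportChart_target, coe_transportChart_symm]
    exact f.contMDiff.comp_contMDiffOn (contMDiffOn_symm_of_mem_maximalAtlas he)

lemma vectorInChart_pushField (X : (p : M) → TangentSpace 𝓘(ℝ, E) p)
    (he : e ∈ IsManifold.maximalAtlas 𝓘(ℝ, E) ∞ M) (hy : y ∈ e.target) :
    vectorInChart (pushField f X) (transportChart f e) y = vectorInChart X e y := by
  have hpush (x : M) (hx : x = e.symm y) : coordDeriv (transportChart f e) (f (e.symm y))
      (mfderiv 𝓘(ℝ, E) 𝓘(ℝ, E) f x (X x) : E) = vectorInChart X e y := by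
    subst hx
    rw [← coordVector_vectorInChart he hy X]
    refine (congrArg _ (coordVector_transportChart f he hy _).symm).trans
      (coordDeriv_coordVector (transportChart_mem_maximalAtlas f he) ?_ _)
    rwa [transportChart_target]
  exact hpush _ (f.symm_apply_apply _)

variable [IsManifold 𝓘(ℝ, E) ∞ M]

lemma HasBasicConcircularField.transport {g : PseudoRiemannianMetric E M}
    {g' : PseudoRiemannianMetric E M'}
    (hf : ∀ e ∈ IsManifold.maximalAtlas 𝓘(ℝ, E) ∞ M, ∀ y ∈ e.target,
      g.inChart e y = g'.inChart (transportChart f e) y)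
    (h : HasBasicConcircularField g) : HasBasicConcircularField g' := by
  obtain ⟨X, ρ, hX, p, hp⟩ := h
  have hcharts (e') (he' : e' ∈ IsManifold.maximalAtlas 𝓘(ℝ, E) ∞ M') :
      ∃ e ∈ IsManifold.maximalAtlas 𝓘(ℝ, E) ∞ M, transportChart f e = e' :=
    ⟨_, transportChart_mem_maximalAtlas f.symm he', transportChart_transportChart_symm f e'⟩
  refine ⟨pushField f X, ρ ∘ f.symm, ⟨contMDiff_of_vectorInChart fun e' he' ↦ ?_,
    hX.smooth_scalar.comp f.symm.contMDiff, fun e' he' y hy u v ↦ ?_⟩, f p, by simpa using hp⟩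
  · obtain ⟨e, he, rfl⟩ := hcharts e' he'
    rw [transportChart_target]
    exact (hX.contDiffOn e he).congr fun y hy ↦ vectorInChart_pushField f X he hy
  · obtain ⟨e, he, rfl⟩ := hcharts e' he'
    rw [transportChart_target] at hy
    have hfield : vectorInChart (pushField f X) (transportChart f e) =ᶠ[nhds y]
        vectorInChart X e :=
      Filter.eventually_of_mem (e.open_target.mem_nhds hy) fun z hz ↦
        vectorInChart_pushField f X he hz
    have hmetric : g'.inChart (transportChart f e) =ᶠ[nhds y] g.inChart e :=
      Filter.eventually_of_mem (e.open_target.mem_nhds hy) fun z hz ↦ (hf e he z hz).symm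
    have hcov : covDerivInChart g' (pushField f X) (transportChart f e) y v =
        covDerivInChart g X e y v := by
      rw [g'.covDerivInChart_eq, g.covDerivInChart_eq, covDeriv_congr hfield, covDeriv, covDeriv,
        connection_congr hmetric]
    rw [hcov, hmetric.eq_of_nhds, hX.eq e he y hy]
    simp [coe_transportChart_symm]

end Transport

section Pullback

open Bundle

variable {E : Type*} [NormedAddCommGroup E] [NormedSpace ℝ E]
  {M : Type*} [TopologicalSpace M] [ChartedSpace E M]
  {M' : Type*} [TopologicalSpace M'] [ChartedSpace E M'] [IsManifold 𝓘(ℝ, E) ∞ M']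
  (f : M ≃ₘ⟮𝓘(ℝ, E), 𝓘(ℝ, E)⟯ M') (g' : PseudoRiemannianMetric E M')

/-- The pullback of the bilinear forms of the metric `g'` by the diffeomorphism `f`. -/
def pullbackForm (p : M) :
    TangentSpace 𝓘(ℝ, E) p →L[ℝ] TangentSpace 𝓘(ℝ, E) p →L[ℝ] ℝ :=
  ContinuousLinearMap.bilinearComp (E := E) (F := E) (E' := E) (F' := E) (G := ℝ) (g'.form (f p))
    (mfderiv 𝓘(ℝ, E) 𝓘(ℝ, E) f p) (mfderiv 𝓘(ℝ, E) 𝓘(ℝ, E) f p)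

lemma pullbackForm_coordVector {e : OpenPartialHomeomorph M E} {y : E}
    (he : e ∈ IsManifold.maximalAtlas 𝓘(ℝ, E) ∞ M) (hy : y ∈ e.target) (v w : E) :
    pullbackForm f g' (e.symm y) (coordVector e y v) (coordVector e y w) =
      g'.inChart (transportChart f e) y v w := by
  rw [g'.inChart_apply, coordVector_transportChart f he hy, coordVector_transportChart f he hy]
  rfl

variable [IsManifold 𝓘(ℝ, E) ∞ M]

lemma symm_trivializationAt_tangentSpace {p q : M} (hq : q ∈ (chartAt E p).source) (v : E) :
    (trivializationAt E (TangentSpace 𝓘(ℝ, E)) p).symm q v =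
      (mfderiv 𝓘(ℝ, E) 𝓘(ℝ, E) (chartAt E p).symm (chartAt E p q) v : E) := by
  have h := TangentBundle.symmL_trivializationAt (I := 𝓘(ℝ, E)) hq
  rw [modelWithCornersSelf_coe, Set.range_id, mfderivWithin_univ] at h
  simp only [mfld_simps] at h
  exact (Trivialization.symmL_apply _ (by simpa) v).symm.trans (DFunLike.congr_fun h v)

lemma trivializationAt_hom_hom_apply {p q : M} (hq : q ∈ (chartAt E p).source)
    (B : TangentSpace 𝓘(ℝ, E) q →L[ℝ] TangentSpace 𝓘(ℝ, E) q →L[ℝ] ℝ) (v w : E) :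
    (trivializationAt (E →L[ℝ] E →L[ℝ] ℝ)
      (fun q : M ↦ TangentSpace 𝓘(ℝ, E) q →L[ℝ] TangentSpace 𝓘(ℝ, E) q →L[ℝ] ℝ) p ⟨q, B⟩).2 v w
      = B (mfderiv 𝓘(ℝ, E) 𝓘(ℝ, E) (chartAt E p).symm (chartAt E p q) v : E)
        (mfderiv 𝓘(ℝ, E) 𝓘(ℝ, E) (chartAt E p).symm (chartAt E p q) w : E) := by
  rw [hom_trivializationAt_apply]
  refine (inCoordinates_apply_eq₂ (F₁ := E) (F₂ := E) (F₃ := ℝ)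
    (E₁ := (TangentSpace 𝓘(ℝ, E) : M → Type _)) (E₂ := (TangentSpace 𝓘(ℝ, E) : M → Type _))
    (E₃ := Trivial M ℝ) (by simpa) (by simpa) (by simp)).trans ?_
  rw [symm_trivializationAt_tangentSpace hq, symm_trivializationAt_tangentSpace hq]
  simp

variable [FiniteDimensional ℝ E]

lemma contMDiff_pullbackForm :
    ContMDiff 𝓘(ℝ, E) (𝓘(ℝ, E).prod 𝓘(ℝ, E →L[ℝ] E →L[ℝ] ℝ)) ∞
      (fun p ↦ TotalSpace.mk' (E →L[ℝ] E →L[ℝ] ℝ)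
        (E := fun p : M ↦ TangentSpace 𝓘(ℝ, E) p →L[ℝ] TangentSpace 𝓘(ℝ, E) p →L[ℝ] ℝ) p
        (pullbackForm f g' p)) := by
  intro p
  have he : chartAt E p ∈ IsManifold.maximalAtlas 𝓘(ℝ, E) ∞ M :=
    IsManifold.chart_mem_maximalAtlas p
  rw [Bundle.contMDiffAt_section]
  have hsmooth : ContMDiffOn 𝓘(ℝ, E) 𝓘(ℝ, E →L[ℝ] E →L[ℝ] ℝ) ∞
      (g'.inChart (transportChart f (chartAt E p)) ∘ chartAt E p) (chartAt E p).source := by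
    refine (g'.contDiffOn_inChart (transportChart_mem_maximalAtlas f he)).contMDiffOn.comp
      (contMDiffOn_of_mem_maximalAtlas he) fun q hq ↦ ?_
    rw [transportChart_target]
    exact (chartAt E p).map_source hq
  have hnear := (chartAt E p).open_source.mem_nhds (mem_chart_source E p)
  refine (hsmooth.contMDiffAt hnear).congr_of_eventuallyEq (Filter.eventually_of_mem hnear
    fun q hq ↦ ContinuousLinearMap.ext fun v ↦ ContinuousLinearMap.ext fun w ↦ ?_)
  rw [trivializationAt_hom_hom_apply hq, Function.comp_apply,
    ← pullbackForm_coordVector f g' he ((chartAt E p).map_source hq), (chartAt E p).left_inv hq]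
  rfl

namespace PseudoRiemannianMetric

/-- The pullback of the metric `g'` by the diffeomorphism `f`. -/
def pullback : PseudoRiemannianMetric E M where
  form := pullbackForm f g'
  symm p v w := g'.symm (f p) (mfderiv 𝓘(ℝ, E) 𝓘(ℝ, E) f p v) (mfderiv 𝓘(ℝ, E) 𝓘(ℝ, E) f p w)
  nondegenerate p v hv := by
    let L := f.mfderivToContinuousLinearEquiv (by simp) p
    refine L.map_eq_zero_iff.1 (g'.nondegenerate (f p) (L v) fun w ↦ ?_)
    rw [← L.apply_symm_apply w]
    exact hv (L.symm w)
  contMDiff := contMDiff_pullbackForm f g'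

lemma inChart_pullback {e : OpenPartialHomeomorph M E} {y : E}
    (he : e ∈ IsManifold.maximalAtlas 𝓘(ℝ, E) ∞ M) (hy : y ∈ e.target) :
    (g'.pullback f).inChart e y = g'.inChart (transportChart f e) y :=
  ContinuousLinearMap.ext fun v ↦ ContinuousLinearMap.ext fun w ↦
    pullbackForm_coordVector f g' he hy v w

end PseudoRiemannianMetric

lemma hasBasicConcircularField_pullback_iff :
    HasBasicConcircularField (g'.pullback f) ↔ HasBasicConcircularField g' := by
  refine ⟨.transport f fun e he y hy ↦ g'.inChart_pullback f he hy,
    .transport f.symm fun e' he' y hy ↦ ?_⟩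
  rw [g'.inChart_pullback f (transportChart_mem_maximalAtlas f.symm he')
    (by rwa [transportChart_target]), transportChart_transportChart_symm]

end Pullback

section GeodesicMappings

variable {E : Type*} [NormedAddCommGroup E] [NormedSpace ℝ E]
  {M : Type*} [TopologicalSpace M] [ChartedSpace E M]
  {e : OpenPartialHomeomorph M E} {y : E} {x : ℝ → E}

lemma mfderiv_chart_symm_comp_ne_zero (he : e ∈ IsManifold.maximalAtlas 𝓘(ℝ, E) ∞ M) {t : ℝ}
    (hxt : x t ∈ e.target) (hx : DifferentiableAt ℝ x t) (hne : deriv x t ≠ 0) :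
    mfderiv 𝓘(ℝ, ℝ) 𝓘(ℝ, E) (e.symm ∘ x) t ≠ 0 := by
  intro hzero
  have hcomp : mfderiv 𝓘(ℝ, ℝ) 𝓘(ℝ, E) (e.symm ∘ x) t =
      (coordVector e (x t)).comp (mfderiv 𝓘(ℝ, ℝ) 𝓘(ℝ, E) x t) :=
    mfderiv_comp t ((mdifferentiable_of_mem_maximalAtlas he).mdifferentiableAt_symm hxt)
      hx.mdifferentiableAt
  rw [hzero, mfderiv_eq_fderiv] at hcomp
  have hvec : coordVector e (x t) (deriv x t) = 0 :=
    (congrArg _ fderiv_apply_one_eq_deriv.symm).trans (DFunLike.congr_fun hcomp 1).symm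
  rw [← coordDeriv_coordVector he hxt (deriv x t), hvec, map_zero] at hne
  exact hne rfl

variable [FiniteDimensional ℝ E] [IsManifold 𝓘(ℝ, E) ∞ M]

lemma isGeodesicCurve_of_acceleration_eq_zero (g : PseudoRiemannianMetric E M)
    (he : e ∈ IsManifold.maximalAtlas 𝓘(ℝ, E) ∞ M) {J : Set ℝ} (hJ : IsOpen J)
    (hJ' : IsPreconnected J) (hx : ContDiffOn ℝ ∞ x J)
    (hgeo : ∀ t ∈ J, x t ∈ e.target ∧ deriv x t ≠ 0 ∧ acceleration (g.inChart e) x t = 0) :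
    IsGeodesicCurve g J (e.symm ∘ x) where
  isOpen := hJ
  isPreconnected := hJ'
  smooth := (contMDiffOn_symm_of_mem_maximalAtlas he).comp hx.contMDiffOn fun t ht ↦ (hgeo t ht).1
  regular t ht := mfderiv_chart_symm_comp_ne_zero he (hgeo t ht).1
    (differentiableAt_of_contDiffOn hx hJ ht) (hgeo t ht).2.1
  eq := by
    refine ⟨0, fun t ht e' he' hte' ↦ ?_⟩
    have hacc := (g.isIsometryOn_transition he he').fderiv_acceleration
      (show x t ∈ e.target ∩ e.symm ⁻¹' e'.source from ⟨(hgeo t ht).1, hte'⟩)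
      (hx.contDiffAt (hJ.mem_nhds ht))
    rw [(hgeo t ht).2.2, map_zero] at hacc
    rw [Pi.zero_apply, zero_smul]
    exact hacc.symm

variable {M' : Type*} [TopologicalSpace M'] [ChartedSpace E M'] [IsManifold 𝓘(ℝ, E) ∞ M']
  {f : M ≃ₘ⟮𝓘(ℝ, E), 𝓘(ℝ, E)⟯ M'} {g : PseudoRiemannianMetric E M}
  {g' : PseudoRiemannianMetric E M'}

lemma IsGeodesicCurve.exists_acceleration_pullback_eq_smul {J : Set ℝ}
    (hγ : IsGeodesicCurve g' J (f ∘ e.symm ∘ x)) (he : e ∈ IsManifold.maximalAtlas 𝓘(ℝ, E) ∞ M)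
    (hx : ∀ t ∈ J, x t ∈ e.target) {t : ℝ} (ht : t ∈ J) :
    ∃ κ : ℝ, acceleration ((g'.pullback f).inChart e) x t = κ • deriv x t := by
  obtain ⟨κ, hκ⟩ := hγ.eq
  have hcurve : transportChart f e ∘ f ∘ e.symm ∘ x =ᶠ[nhds t] x :=
    Filter.eventually_of_mem (hγ.isOpen.mem_nhds ht) fun s hs ↦ by
      simp [coe_transportChart, e.right_inv (hx s hs)]
  have hsource : (f ∘ e.symm ∘ x) t ∈ (transportChart f e).source := by
    rw [transportChart_source]
    simpa using e.map_target (hx t ht)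
  have hmetric : (g'.pullback f).inChart e =ᶠ[nhds (x t)] g'.inChart (transportChart f e) :=
    Filter.eventually_of_mem (e.open_target.mem_nhds (hx t ht)) fun z hz ↦
      g'.inChart_pullback f he hz
  have hgeo := hκ t ht _ (transportChart_mem_maximalAtlas f he) hsource
  rw [hcurve.deriv.deriv_eq, hcurve.deriv_eq,
    show transportChart f e ((f ∘ e.symm ∘ x) t) = x t from hcurve.eq_of_nhds] at hgeo
  refine ⟨κ t, ?_⟩
  rw [acceleration, connection_congr hmetric]
  exact hgeo

lemma IsGeodesicMapping.exists_connection_sub_eq_smul (hf : IsGeodesicMapping g g' f)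
    (he : e ∈ IsManifold.maximalAtlas 𝓘(ℝ, E) ∞ M) (hy : y ∈ e.target) {u : E} (hu : u ≠ 0) :
    ∃ κ : ℝ, (connection ((g'.pullback f).inChart e) y - connection (g.inChart e) y) u u =
      κ • u := by
  obtain ⟨ε, hε, x, rfl, rfl, hx, hgeo⟩ := (g.isMetricOn_inChart he).exists_geodesic hy hu
  have hmem : (0 : ℝ) ∈ Set.Ioo (-ε) ε := ⟨neg_neg_of_pos hε, hε⟩
  obtain ⟨κ, hκ⟩ := (hf _ _ (isGeodesicCurve_of_acceleration_eq_zero g he isOpen_Ioo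
    isPreconnected_Ioo hx hgeo)).exists_acceleration_pullback_eq_smul he
    (fun t ht ↦ (hgeo t ht).1) hmem
  refine ⟨κ, ?_⟩
  rw [← hκ, ← sub_zero (acceleration _ x 0), ← (hgeo 0 hmem).2.2]
  simp only [acceleration, sub_apply]
  abel

theorem IsGeodesicMapping.projectivelyEquivalent (hf : IsGeodesicMapping g g' f) :
    ProjectivelyEquivalent g (g'.pullback f) := by
  intro e he y hy
  have hsymm (u v : E) :
      (connection ((g'.pullback f).inChart e) y - connection (g.inChart e) y) u v =
        (connection ((g'.pullback f).inChart e) y - connection (g.inChart e) y) v u := by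
    simp only [sub_apply, (g.isMetricOn_inChart he).connection_symm hy u v,
      ((g'.pullback f).isMetricOn_inChart he).connection_symm hy u v]
  obtain ⟨ψ, hψ⟩ := exists_oneForm_of_forall_eq_smul
    (T := (connection ((g'.pullback f).inChart e) y - connection (g.inChart e) y).toLinearMap₁₂)
    hsymm fun u hu ↦ hf.exists_connection_sub_eq_smul he hy hu
  refine ⟨ψ.toContinuousLinearMap, fun u v ↦ ?_⟩
  rw [add_assoc, ← sub_eq_iff_eq_add']
  exact hψ u v

end GeodesicMappings

theorem theorem4_general {E : Type*} [NormedAddCommGroup E] [NormedSpace ℝ E]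
    [FiniteDimensional ℝ E]
    {M : Type*} [TopologicalSpace M] [ChartedSpace E M] [IsManifold 𝓘(ℝ, E) ∞ M]
    {M' : Type*} [TopologicalSpace M'] [ChartedSpace E M'] [IsManifold 𝓘(ℝ, E) ∞ M']
    {g : PseudoRiemannianMetric E M} {g' : PseudoRiemannianMetric E M'}
    (h : AdmitsGeodesicMapping g g') :
    HasBasicConcircularField g' ↔ HasBasicConcircularField g := by
  obtain ⟨f, hf⟩ := h
  have hproj := hf.projectivelyEquivalent
  rw [← hasBasicConcircularField_pullback_iff f]
  exact ⟨hproj.symm.hasBasicConcircularField, hproj.hasBasicConcircularField⟩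

end

theorem theorem4 (n : ℕ)
    {M : Type*} [TopologicalSpace M] [T2Space M] [SecondCountableTopology M]
    [ChartedSpace (EuclideanSpace ℝ (Fin n)) M]
    [IsManifold 𝓘(ℝ, EuclideanSpace ℝ (Fin n)) ∞ M]
    {M' : Type*} [TopologicalSpace M'] [T2Space M'] [SecondCountableTopology M']
    [ChartedSpace (EuclideanSpace ℝ (Fin n)) M']
    [IsManifold 𝓘(ℝ, EuclideanSpace ℝ (Fin n)) ∞ M']
    (g : PseudoRiemannianMetric (EuclideanSpace ℝ (Fin n)) M)
    (g' : PseudoRiemannianMetric (EuclideanSpace ℝ (Fin n)) M')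
    (h : AdmitsGeodesicMapping g g') :
    (HasBasicConcircularField g' → HasBasicConcircularField g) ∧
      (HasBasicConcircularField g → HasBasicConcircularField g') :=
  iff_def.1 (theorem4_general h)
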